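/- Let $N\ge 1$ be an integer and $\hbar>0$. For a Schwartz function $\phi\in\mathcal S(\mathbb R^N)$ (complex valued) with $\|\phi\|_{L^2(\mathbb R^N)}=1$, let $U_\phi:L^2(\mathbb R^N_x)\to L^2(\mathbb R^{2N}_z)$, $z=(x,p)$, be the Wigner wave-packet transform $$U_\phi\psi(x,p)=\Big(\frac1{2\pi\hbar}\Big)^{N/2}e^{\frac{i}{2\hbar}p\cdot x}\int_{\mathbb R^N}e^{-\frac{i}{\hbar}p\cdot x'}\psi(x')\,\phi(x-x')\,dx',$$ and let $\mathcal H_\phi\subset L^2(\mathbb R^{2N})$ be its range, with the inner product of $L^2(\mathbb R^{2N})$. Let $\phi_\hbar(x)=(\pi\hbar)^{-N/4}\exp\big(-\frac{1}{2\hbar}|x|^2\big)$ be the standard Gaussian. (i) A function $\Psi\in L^2(\mathbb R^{2N})$ belongs to $\mathcal H_{\phi_\hbar}$ if and only if $$\Big(\frac{\partial}{\partial x_j}-i\frac{\partial}{\partial p_j}\Big)\Big[\exp\Big(\frac{1}{4\hbar}|z|^2\Big)\Psi(z)\Big]=0\qquad(1\le j\le N)$$ in the sense of distributions on $\mathbb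 R^{2N}$, where $|z|^2=|x|^2+|p|^2$. (ii) For every $\phi\in\mathcal S(\mathbb R^N)$ with $\|\phi\|_{L^2}=1$, the space $\mathcal H_\phi$ is linearly isometric to $\mathcal H_{\phi_\hbar}$, i.e. there is a complex-linear isometry of $\mathcal H_\phi$ onto $\mathcal H_{\phi_\hbar}$. -/

import Mathlib

open MeasureTheory SchwartzMap FourierTransform
open scoped ContDiff ENNReal

noncomputable section

namespace WavePacket

theorem gaussian_smul_decay {E : Type} [NormedAddCommGroup E] [InnerProductSpace ℝ E]
    {a : ℝ} (n : ℕ) : ∀ {F : Type} [NormedAddCommGroup F] [NormedSpace ℝ F] (g : E → F),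
    g.HasTemperateGrowth → ∃ (k : ℕ) (C : ℝ), ∀ x,
      ‖iteratedFDeriv ℝ n (fun x => Real.exp (-a * ‖x‖ ^ 2) • g x) x‖
        ≤ C * (1 + ‖x‖) ^ k * Real.exp (-a * ‖x‖ ^ 2) := by
  induction n with
  | zero =>
    intro F _ _ g hg
    obtain ⟨k, C, h⟩ := hg.2 0
    refine ⟨k, C, fun x => ?_⟩
    have := h x
    simp only [norm_iteratedFDeriv_zero, norm_smul, Real.norm_eq_abs, Real.abs_exp] at this ⊢
    rw [mul_comm]
    gcongr
  | succ n ih =>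
    intro F _ _ g hg
    have hd : fderiv ℝ (fun x : E => Real.exp (-a * ‖x‖ ^ 2) • g x) =
        fun x => Real.exp (-a * ‖x‖ ^ 2) •
          (fderiv ℝ g x + (-(2 * a)) • (innerSL ℝ x).smulRight (g x)) := by
      funext x
      have h1 : HasFDerivAt g (fderiv ℝ g x) x :=
        ((hg.1.differentiable (by simp)) x).hasFDerivAt
      have h2 : HasFDerivAt (fun x : E => Real.exp (-a * ‖x‖ ^ 2)) _ x :=
        (((hasStrictFDerivAt_norm_sq x).hasFDerivAt).const_mul (-a)).exp
      refine (h2.smul h1).fderiv.trans ?_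
      ext v
      simp [smul_smul, smul_add]
      congr 1
      ring
    have hf : (fderiv ℝ g).HasTemperateGrowth := by
      refine ⟨hg.1.fderiv_right (by simp), fun m => ?_⟩
      obtain ⟨k, C, h⟩ := hg.2 (m + 1)
      exact ⟨k, C, fun x => by rw [norm_iteratedFDeriv_fderiv]; exact h x⟩
    have hs : (fun x : E => (innerSL ℝ x).smulRight (g x)).HasTemperateGrowth :=
      (ContinuousLinearMap.smulRightL ℝ E F).bilinear_hasTemperateGrowth
        (innerSL ℝ (E := E)).hasTemperateGrowth hg
    obtain ⟨k, C, h⟩ := ih _ (hf.add ((Function.HasTemperateGrowth.const (-(2 * a))).smul hs))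
    refine ⟨k, C, fun x => ?_⟩
    rw [← norm_iteratedFDeriv_fderiv, hd]
    exact h x

theorem polynomial_mul_gaussian_bounded {a : ℝ} (ha : 0 < a) (m : ℕ) :
    ∃ C, ∀ t : ℝ, 0 ≤ t → (1 + t) ^ m * Real.exp (-a * t ^ 2) ≤ C := by
  refine ⟨m.factorial * Real.exp (1 + (1 / (4 * a))), fun t ht => ?_⟩
  have h1 : (1 + t) ^ m ≤ m.factorial * Real.exp (1 + t) := by
    have := Real.pow_div_factorial_le_exp (1 + t) (by positivity) m
    rw [div_le_iff₀ (by positivity)] at this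
    linarith
  calc _ ≤ m.factorial * Real.exp (1 + t) * Real.exp (-a * t ^ 2) := by gcongr
    _ = m.factorial * Real.exp (1 + t + -a * t ^ 2) := by rw [mul_assoc, ← Real.exp_add]
    _ ≤ _ := by
      refine mul_le_mul_of_nonneg_left (Real.exp_le_exp.mpr ?_) (by positivity)
      have : 1 / (4 * a) - t + a * t ^ 2 = (2 * a * t - 1) ^ 2 / (4 * a) := by field_simp; ring
      have h2 : 0 ≤ (2 * a * t - 1) ^ 2 / (4 * a) := by positivity
      linarith

theorem fourier_L1_L2 {V : Type} [NormedAddCommGroup V] [InnerProductSpace ℝ V]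
    [FiniteDimensional ℝ V] [MeasurableSpace V] [BorelSpace V] {f : V → ℂ}
    (h1 : Integrable f) (h2 : MemLp f 2) :
    ∫⁻ v, ‖𝓕 f v‖ₑ ^ 2 = ∫⁻ v, ‖f v‖ₑ ^ 2 := by
  set g : Lp ℂ 2 (volume : Measure V) := h2.toLp f
  have hcont : Continuous (𝓕 f) := 
    VectorFourier.fourierIntegral_continuous Real.continuous_fourierChar
      (by exact continuous_inner) h1
  have hae : 𝓕 f =ᵐ[volume] (𝓕 g : Lp ℂ 2 (volume : Measure V)) := by
    apply ae_eq_of_integral_contDiff_smul_eq (hcont.locallyIntegrable)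
      ((Lp.memLp _).locallyIntegrable (by norm_num))
    intro u hu hc
    have hg₁ : HasCompactSupport (Complex.ofRealCLM ∘ u) := hc.comp_left rfl
    have hg₂ : ContDiff ℝ ∞ (Complex.ofRealCLM ∘ u) := by fun_prop
    set w : 𝓢(V, ℂ) := hg₁.toSchwartzMap hg₂
    have e1 := DFunLike.congr_fun (Lp.fourier_toTemperedDistribution_eq g) w
    rw [TemperedDistribution.fourier_apply] at e1
    simp only [Lp.toTemperedDistribution_apply] at e1
    have e2 : ∫ x, (𝓕 w) x • g x = ∫ x, 𝓕 (w : V → ℂ) x • f x := by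
      apply integral_congr_ae
      filter_upwards [h2.coeFn_toLp] with x hx
      rw [hx]; rfl
    have e3 : ∫ x, 𝓕 (w : V → ℂ) x • f x = ∫ x, w x • 𝓕 f x := by
      simpa using! (VectorFourier.integral_fourierIntegral_smul_eq_flip (L := innerₗ V)
        Real.continuous_fourierChar continuous_inner w.integrable h1)
    have e4 : ∀ x, w x = (u x : ℂ) := fun x => rfl
    rw [e2, e3] at e1
    simpa [e4] using e1
  have hn : ‖(𝓕 g : Lp ℂ 2 (volume : Measure V))‖ₑ = ‖g‖ₑ := by
    rw [← ofReal_norm, ← ofReal_norm, Lp.norm_fourier_eq]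
  rw [Lp.enorm_def, Lp.enorm_def, ← eLpNorm_congr_ae hae, eLpNorm_congr_ae h2.coeFn_toLp,
    eLpNorm_eq_lintegral_rpow_enorm_toReal (by norm_num) (by norm_num),
    eLpNorm_eq_lintegral_rpow_enorm_toReal (by norm_num) (by norm_num)] at hn
  exact ENNReal.rpow_left_injective (two_ne_zero' ℝ |> inv_ne_zero) (by simpa using hn)

/-- Configuration space `ℝ^N` with its Euclidean structure and Lebesgue measure. -/
abbrev Config (N : ℕ) : Type := EuclideanSpace ℝ (Fin N)

/-- Phase space `ℝ^N × ℝ^N`, with points `z = (x, p)` and Lebesgue measure. -/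
abbrev Phase (N : ℕ) : Type := Config N × Config N

/-- The standard Gaussian `φ_ħ(x) = (πħ)^(-N/4) exp(-|x|²/(2ħ))` as a Schwartz function. -/
def standardGaussian (N : ℕ) (ħ : ℝ) (hħ : 0 < ħ) : 𝓢(Config N, ℂ) where
  toFun x := ((((1 / (Real.pi * ħ)) ^ ((N : ℝ) / 4) *
    Real.exp (-(1 / (2 * ħ)) * ‖x‖ ^ 2) : ℝ)) : ℂ)
  smooth' := by
    have : ContDiff ℝ ∞ fun x : Config N => (1 / (Real.pi * ħ)) ^ ((N : ℝ) / 4) *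
        Real.exp (-(1 / (2 * ħ)) * ‖x‖ ^ 2) :=
      contDiff_const.mul (contDiff_const.mul (contDiff_norm_sq ℝ)).exp
    exact Complex.ofRealCLM.contDiff.comp this
  decay' := by
    intro k n
    obtain ⟨m, C, h⟩ := gaussian_smul_decay (E := Config N) (a := 1 / (2 * ħ)) n
      (fun _ => (((1 / (Real.pi * ħ)) ^ ((N : ℝ) / 4) : ℝ) : ℂ)) (.const _)
    obtain ⟨D, hD⟩ := polynomial_mul_gaussian_bounded
      (a := 1 / (2 * ħ)) (by positivity) (k + m)
    refine ⟨|C| * D, fun x => ?_⟩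
    have he : (fun x : Config N => ((((1 / (Real.pi * ħ)) ^ ((N : ℝ) / 4) *
        Real.exp (-(1 / (2 * ħ)) * ‖x‖ ^ 2) : ℝ)) : ℂ)) =
        fun x => Real.exp (-(1 / (2 * ħ)) * ‖x‖ ^ 2) •
          (((1 / (Real.pi * ħ)) ^ ((N : ℝ) / 4) : ℝ) : ℂ) := by
      funext x
      rw [Complex.real_smul, mul_comm, Complex.ofReal_mul]
    rw [he]
    calc _ ≤ (1 + ‖x‖) ^ k * (|C| * (1 + ‖x‖) ^ m * Real.exp (-(1 / (2 * ħ)) * ‖x‖ ^ 2)) := by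
          refine mul_le_mul (pow_le_pow_left₀ (norm_nonneg _) (by linarith) _) ((h x).trans ?_)
            (norm_nonneg _) (by positivity)
          gcongr
          exact le_abs_self C
      _ = |C| * ((1 + ‖x‖) ^ (k + m) * Real.exp (-(1 / (2 * ħ)) * ‖x‖ ^ 2)) := by ring
      _ ≤ _ := by
          gcongr
          exact hD _ (norm_nonneg x)

/-- The integral defining the Wigner wave-packet transform:
`(2πħ)^(-N/2) exp(i p·x/(2ħ)) ∫ exp(-i p·x'/ħ) ψ(x') φ(x - x') dx'` at `z = (x, p)`. -/
def wavePacketIntegral {N : ℕ} (ħ : ℝ) (φ ψ : Config N → ℂ) (z : Phase N) : ℂ :=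
  (((1 / (2 * Real.pi * ħ)) ^ ((N : ℝ) / 2) : ℝ) : ℂ) *
    Complex.exp (Complex.I / (2 * ħ) * (inner ℝ z.2 z.1 : ℝ)) *
    ∫ y : Config N, Complex.exp (-(Complex.I / ħ) * (inner ℝ z.2 y : ℝ)) * (ψ y * φ (z.1 - y))

theorem integrable_mul_translate {N : ℕ} (φ : 𝓢(Config N, ℂ))
    {ψ : Config N → ℂ} (hψ : MemLp ψ 2) (x : Config N) :
    Integrable (fun y => ψ y * φ (x - y)) :=
  hψ.integrable_mul ((φ.memLp 2).comp_measurePreserving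
    (Measure.measurePreserving_sub_left volume x))

theorem integrable_wavePacket {N : ℕ} (ħ : ℝ) (φ : 𝓢(Config N, ℂ))
    {ψ : Config N → ℂ} (hψ : MemLp ψ 2) (z : Phase N) :
    Integrable (fun y : Config N =>
      Complex.exp (-(Complex.I / ħ) * (inner ℝ z.2 y : ℝ)) * (ψ y * φ (z.1 - y))) := by
  refine (integrable_mul_translate φ hψ z.1).bdd_mul (c := 1)
    (Continuous.aestronglyMeasurable (by fun_prop)) (ae_of_all _ fun y => ?_)
  rw [Complex.norm_exp]
  simp [Complex.div_re]

theorem memLp_mul_translate {N : ℕ} (φ : 𝓢(Config N, ℂ))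
    {ψ : Config N → ℂ} (hψ : MemLp ψ 2) (x : Config N) :
    MemLp (fun y => ψ y * φ (x - y)) 2 := by
  have h := (φ.memLp_top).comp_measurePreserving (Measure.measurePreserving_sub_left volume x)
  exact h.mul' hψ

theorem lintegral_fourier_scaled {N : ℕ} {ħ : ℝ} (hħ : 0 < ħ) {f : Config N → ℂ}
    (h1 : Integrable f) (h2 : MemLp f 2) :
    ∫⁻ p : Config N, ‖∫ y, Complex.exp (-(Complex.I / ħ) * (inner ℝ p y : ℝ)) * f y‖ₑ ^ 2 =
      ENNReal.ofReal |((2 * Real.pi * ħ)⁻¹ ^ N)⁻¹| * ∫⁻ y, ‖f y‖ₑ ^ 2 := by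
  have hc : (2 * Real.pi * ħ)⁻¹ ≠ 0 := by positivity
  have he : ∀ p : Config N, ∫ y, Complex.exp (-(Complex.I / ħ) * (inner ℝ p y : ℝ)) * f y =
      𝓕 f ((2 * Real.pi * ħ)⁻¹ • p) := by
    intro p
    rw [Real.fourier_eq']
    congr 1
    funext y
    rw [smul_eq_mul, real_inner_smul_right, real_inner_comm]
    congr 2
    push_cast
    have : (Real.pi : ℂ) ≠ 0 := by exact_mod_cast Real.pi_ne_zero
    have : (ħ : ℂ) ≠ 0 := by exact_mod_cast hħ.ne'
    field_simp
  have hcont : Continuous (𝓕 f) :=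
    VectorFourier.fourierIntegral_continuous Real.continuous_fourierChar
      (by exact continuous_inner) h1
  simp_rw [he]
  rw [← fourier_L1_L2 h1 h2, ← smul_eq_mul (ENNReal.ofReal _), ← lintegral_smul_measure]
  have hm := Measure.map_addHaar_smul (volume : Measure (Config N)) hc
  rw [finrank_euclideanSpace, Fintype.card_fin] at hm
  rw [← hm, lintegral_map (by fun_prop) (by fun_prop)]

theorem stronglyMeasurable_wavePacketIntegral {N : ℕ} (ħ : ℝ) (φ : 𝓢(Config N, ℂ))
    {ψ : Config N → ℂ} (hψ : StronglyMeasurable ψ) :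
    StronglyMeasurable (wavePacketIntegral ħ φ ψ) := by
  refine StronglyMeasurable.mul (Continuous.stronglyMeasurable (by fun_prop)) ?_
  refine StronglyMeasurable.integral_prod_right' (f := fun q : Phase N × Config N =>
    Complex.exp (-(Complex.I / ħ) * (inner ℝ q.1.2 q.2 : ℝ)) * (ψ q.2 * φ (q.1.1 - q.2))) ?_
  refine StronglyMeasurable.mul (Continuous.stronglyMeasurable (by fun_prop)) ?_
  refine StronglyMeasurable.mul (hψ.comp_measurable measurable_snd) ?_
  exact Continuous.stronglyMeasurable (by fun_prop)

theorem memLp_wavePacketIntegral {N : ℕ} {ħ : ℝ} (hħ : 0 < ħ) (φ : 𝓢(Config N, ℂ))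
    (ψ : Lp ℂ 2 (volume : Measure (Config N))) :
    MemLp (wavePacketIntegral ħ φ ψ) 2 (volume : Measure (Phase N)) := by
  have hsm := Lp.stronglyMeasurable ψ
  have hψ := Lp.memLp ψ
  have hU := stronglyMeasurable_wavePacketIntegral ħ φ hsm
  refine ⟨hU.aestronglyMeasurable, ?_⟩
  rw [eLpNorm_lt_top_iff_lintegral_rpow_enorm_lt_top (by norm_num) (by norm_num)]
  simp only [ENNReal.toReal_ofNat, ENNReal.rpow_ofNat]
  set c : ℝ := (1 / (2 * Real.pi * ħ)) ^ ((N : ℝ) / 2) with hcdef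
  set d : ℝ≥0∞ := ENNReal.ofReal |((2 * Real.pi * ħ)⁻¹ ^ N)⁻¹| with hd
  have hpt : ∀ z : Phase N, ‖wavePacketIntegral ħ φ ψ z‖ₑ ^ 2 = ‖(c : ℂ)‖ₑ ^ 2 *
      ‖∫ y : Config N, Complex.exp (-(Complex.I / ħ) * (inner ℝ z.2 y : ℝ)) *
        (ψ y * φ (z.1 - y))‖ₑ ^ 2 := by
    intro z
    have h1 : ‖Complex.exp (Complex.I / (2 * ħ) * (inner ℝ z.2 z.1 : ℝ))‖ₑ = 1 := by
      rw [← ofReal_norm, Complex.norm_exp]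
      simp [Complex.div_re]
    rw [wavePacketIntegral, enorm_mul, enorm_mul, h1, mul_one, mul_pow]
  have hsq : ∀ {V : Type} [MeasurableSpace V] {μ : Measure V} {f : V → ℂ}, MemLp f 2 μ →
      ∫⁻ v, ‖f v‖ₑ ^ 2 ∂μ < ⊤ := by
    intro V _ μ f hf
    have := (eLpNorm_lt_top_iff_lintegral_rpow_enorm_lt_top (by norm_num) (by norm_num)).1 hf.2
    simpa using this
  have hψm : Measurable fun y => ‖ψ y‖ₑ ^ 2 := (hsm.measurable.enorm).pow_const 2
  have hφm : Measurable fun q : Config N × Config N => ‖φ (q.1 - q.2)‖ₑ ^ 2 :=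
    ((φ.continuous.comp (continuous_fst.sub continuous_snd)).measurable.enorm).pow_const 2
  rw [Measure.volume_eq_prod, lintegral_prod _ (hU.measurable.enorm.pow_const 2).aemeasurable]
  have hin : ∀ x : Config N, ∫⁻ p : Config N, ‖wavePacketIntegral ħ φ ψ (x, p)‖ₑ ^ 2 =
      ‖(c : ℂ)‖ₑ ^ 2 * (d * ∫⁻ y, ‖ψ y‖ₑ ^ 2 * ‖φ (x - y)‖ₑ ^ 2) := by
    intro x
    simp_rw [hpt]
    rw [lintegral_const_mul' _ _ (by simp)]
    rw [lintegral_fourier_scaled hħ (integrable_mul_translate φ hψ x)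
      (memLp_mul_translate φ hψ x)]
    simp_rw [enorm_mul, mul_pow]
    rfl
  simp_rw [hin]
  rw [lintegral_const_mul' _ _ (by simp), lintegral_const_mul' _ _ (by simp [hd])]
  refine ENNReal.mul_lt_top (by simp) (ENNReal.mul_lt_top (by simp [hd]) ?_)
  rw [lintegral_lintegral_swap
    (((hψm.comp measurable_snd).mul hφm).aemeasurable)]
  have hy : ∀ y : Config N, ∫⁻ x, ‖ψ y‖ₑ ^ 2 * ‖φ (x - y)‖ₑ ^ 2 =
      ‖ψ y‖ₑ ^ 2 * ∫⁻ x, ‖φ x‖ₑ ^ 2 := by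
    intro y
    rw [lintegral_const_mul' _ _ (by simp),
      lintegral_sub_right_eq_self (fun x => ‖φ x‖ₑ ^ 2) y]
  simp_rw [hy]
  rw [lintegral_mul_const _ hψm]
  exact ENNReal.mul_lt_top (hsq hψ) (hsq (φ.memLp 2))

/-- The Wigner wave-packet transform `U_φ : L²(ℝ^N) → L²(ℝ^{2N})` with window `φ`. -/
def wavePacketTransform {N : ℕ} (ħ : ℝ) (hħ : 0 < ħ) (φ : 𝓢(Config N, ℂ)) :
    Lp ℂ 2 (volume : Measure (Config N)) →ₗ[ℂ] Lp ℂ 2 (volume : Measure (Phase N)) where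
  toFun ψ := (memLp_wavePacketIntegral hħ φ ψ).toLp (wavePacketIntegral ħ φ ψ)
  map_add' ψ₁ ψ₂ := by
    rw [← MemLp.toLp_add]
    apply MemLp.toLp_congr
    refine ae_of_all _ fun z => ?_
    simp only [wavePacketIntegral, Pi.add_apply]
    rw [← mul_add, ← integral_add (integrable_wavePacket ħ φ (Lp.memLp ψ₁) z)
      (integrable_wavePacket ħ φ (Lp.memLp ψ₂) z)]
    congr 1
    apply integral_congr_ae
    filter_upwards [Lp.coeFn_add ψ₁ ψ₂] with y hy
    rw [hy, Pi.add_apply]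
    ring
  map_smul' a ψ := by
    rw [RingHom.id_apply, ← MemLp.toLp_const_smul]
    apply MemLp.toLp_congr
    refine ae_of_all _ fun z => ?_
    simp only [wavePacketIntegral, Pi.smul_apply, smul_eq_mul]
    rw [mul_left_comm a, ← integral_const_mul a]
    congr 1
    apply integral_congr_ae
    filter_upwards [Lp.coeFn_smul a ψ] with y hy
    rw [hy, Pi.smul_apply, smul_eq_mul]
    ring

/-- The range `H_φ` of `U_φ`, with the inner product of `L²(ℝ^{2N})`. -/
def wavePacketRange {N : ℕ} (ħ : ℝ) (hħ : 0 < ħ) (φ : 𝓢(Config N, ℂ)) :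
    Submodule ℂ (Lp ℂ 2 (volume : Measure (Phase N))) :=
  LinearMap.range (wavePacketTransform ħ hħ φ)

/-- `(∂/∂x_j - i ∂/∂p_j) F = 0` on phase space in the sense of distributions, for a locally
integrable function `F`: `-∫ F (∂χ/∂x_j - i ∂χ/∂p_j) dz = 0` for all test functions `χ`. -/
def SatisfiesCauchyRiemann {N : ℕ} (j : Fin N) (F : Phase N → ℂ) : Prop :=
  LocallyIntegrable F ∧
    ∀ χ : Phase N → ℂ, ContDiff ℝ ∞ χ → HasCompactSupport χ →
      -∫ z, F z * (fderiv ℝ χ z (EuclideanSpace.single j 1, 0) -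
        Complex.I * fderiv ℝ χ z (0, EuclideanSpace.single j 1)) = 0

end WavePacket

end

noncomputable section

namespace WavePacket

/-! For fixed `x`, the transform is a rescaled Fourier transform of `ψ(y) φ(x - y)`. Plancherel in
`p` and Tonelli in `x` therefore make `U_φ` an isometry for every normalized window, and (ii) is the
composition of one isometry with the inverse of another.

For (i), write `w_j = x_j + i p_j`. With the Gaussian window, the packet `exp(-|y|²/(2ħ) + γ·y)`
goes to a nonzero multiple of `exp(-|z|²/(4ħ) + γ·w̄/2)` (`wavePacketIntegral_gaussianPacket`). Once
the Gaussian weight is removed, this is a function of `w̄` alone, and `∂/∂x_j - i ∂/∂p_j` kills it.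
Packets span a dense subspace (`eq_zero_of_inner_gaussianPacket`) and each distributional equation
is a bounded functional of `ψ`, so the whole range satisfies the equations.

Conversely, the range is closed, so it is enough to show that a solution `Ψ` orthogonal to it
vanishes. Put `I(α, β) = ∫ Ψ exp(-|z|²/(4ħ) + α·w̄ + β·w)`. Orthogonality to the transformed packets
says `I(0, β) = 0`. Testing the equations against `exp(-|z|²/(2ħ) + α·w̄ + β·w)` shows that `t ↦
I(tα, β)` solves a linear ODE, so `I` vanishes identically. For suitable `α, β` the linear exponent
is purely imaginary, and `I` is then the Fourier transform of `Ψ exp(-|z|²/(4ħ))`; hence `Ψ = 0`. No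
regularity theory for weak solutions is needed. -/

/-! ### Injectivity of the Fourier transform on L¹ ∩ L². -/

theorem ae_eq_zero_of_fourier_eq_zero {V : Type} [NormedAddCommGroup V] [InnerProductSpace ℝ V]
    [FiniteDimensional ℝ V] [MeasurableSpace V] [BorelSpace V] {f : V → ℂ}
    (h1 : Integrable f) (h2 : MemLp f 2) (h : ∀ ξ, 𝓕 f ξ = 0) : f =ᵐ[volume] 0 := by
  have e := fourier_L1_L2 h1 h2
  simp only [h, enorm_zero, ne_eq, OfNat.ofNat_ne_zero, not_false_eq_true, zero_pow,
    lintegral_zero] at e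
  rw [eq_comm, lintegral_eq_zero_iff' (h1.aestronglyMeasurable.enorm.pow_const 2)] at e
  filter_upwards [e] with x hx
  simpa using hx

theorem ae_eq_zero_of_integral_mul_cexp_inner {V : Type} [NormedAddCommGroup V]
    [InnerProductSpace ℝ V] [FiniteDimensional ℝ V] [MeasurableSpace V] [BorelSpace V] {f : V → ℂ}
    (h1 : Integrable f) (h2 : MemLp f 2)
    (h : ∀ ξ : V, ∫ v, f v * Complex.exp (-(Complex.I * (inner ℝ ξ v : ℝ))) = 0) :
    f =ᵐ[volume] 0 := by
  refine ae_eq_zero_of_fourier_eq_zero h1 h2 fun ξ => ?_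
  rw [Real.fourier_eq', ← h ((2 * Real.pi) • ξ)]
  congr 1
  funext v
  rw [smul_eq_mul, mul_comm, real_inner_smul_left, real_inner_comm]
  congr 2
  push_cast
  ring

/-- `Phase N` carries the sup norm and so is not an inner product space. The claim is transported
through the measure-preserving identification with the L² product. -/
theorem ae_eq_zero_of_phase_fourier_eq_zero {N : ℕ} {f : Phase N → ℂ}
    (h1 : Integrable f) (h2 : MemLp f 2)
    (h : ∀ ξ η : Config N, ∫ z, f z *
      Complex.exp (-(Complex.I * ((inner ℝ ξ z.1 + inner ℝ η z.2 : ℝ) : ℂ))) = 0) :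
    f =ᵐ[volume] 0 := by
  have hm := WithLp.volume_preserving_ofLp (Config N) (Config N)
  have hm' := WithLp.volume_preserving_toLp (Config N) (Config N)
  have he : MeasurableEmbedding (@WithLp.ofLp 2 (Config N × Config N)) :=
    (MeasurableEquiv.toLp 2 (Config N × Config N)).symm.measurableEmbedding
  have key : (f ∘ @WithLp.ofLp 2 (Config N × Config N)) =ᵐ[volume] 0 := by
    refine ae_eq_zero_of_integral_mul_cexp_inner (hm.integrable_comp_of_integrable h1)
      (h2.comp_measurePreserving hm) fun ξ => ?_
    rw [← h ξ.fst ξ.snd, ← hm.integral_comp he]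
    rfl
  exact hm'.quasiMeasurePreserving.ae_eq_comp key

/-! ### The transform as an isometry. -/

/-- Plancherel in `p` leaves `∫∫ |ψ(y)|² |φ(x - y)|²`, which factors by Tonelli and translation
invariance. -/
theorem lintegral_enorm_sq_wavePacketIntegral {N : ℕ} {ħ : ℝ} (hħ : 0 < ħ) (φ : 𝓢(Config N, ℂ))
    (ψ : Lp ℂ 2 (volume : Measure (Config N))) :
    ∫⁻ z, ‖wavePacketIntegral ħ φ ψ z‖ₑ ^ 2 = (∫⁻ y, ‖ψ y‖ₑ ^ 2) * ∫⁻ y, ‖φ y‖ₑ ^ 2 := by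
  have hsm := Lp.stronglyMeasurable ψ
  have hψ := Lp.memLp ψ
  have hU := stronglyMeasurable_wavePacketIntegral ħ φ hsm
  set c : ℝ := (1 / (2 * Real.pi * ħ)) ^ ((N : ℝ) / 2) with hcdef
  set d : ℝ≥0∞ := ENNReal.ofReal |((2 * Real.pi * ħ)⁻¹ ^ N)⁻¹| with hd
  -- The square of the prefactor `(2πħ)^(-N/2)` cancels the Jacobian of the rescaling `p ↦ p/(2πħ)`.
  have hcd : ‖(c : ℂ)‖ₑ ^ 2 * d = 1 := by
    have h0 : 0 < 1 / (2 * Real.pi * ħ) := by positivity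
    have hc2 : c ^ 2 = (2 * Real.pi * ħ)⁻¹ ^ N := by
      rw [hcdef, ← Real.rpow_natCast, ← Real.rpow_mul h0.le, one_div, ← Real.rpow_natCast]
      congr 1
      push_cast
      ring
    rw [← ofReal_norm, ← ENNReal.ofReal_pow (norm_nonneg _), hd,
      ← ENNReal.ofReal_mul (by positivity), Complex.norm_real, Real.norm_eq_abs, sq_abs, hc2,
      abs_of_pos (by positivity), mul_inv_cancel₀ (by positivity), ENNReal.ofReal_one]
  have hpt : ∀ z : Phase N, ‖wavePacketIntegral ħ φ ψ z‖ₑ ^ 2 = ‖(c : ℂ)‖ₑ ^ 2 *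
      ‖∫ y : Config N, Complex.exp (-(Complex.I / ħ) * (inner ℝ z.2 y : ℝ)) *
        (ψ y * φ (z.1 - y))‖ₑ ^ 2 := by
    intro z
    have h1 : ‖Complex.exp (Complex.I / (2 * ħ) * (inner ℝ z.2 z.1 : ℝ))‖ₑ = 1 := by
      rw [← ofReal_norm, Complex.norm_exp]
      simp [Complex.div_re]
    rw [wavePacketIntegral, enorm_mul, enorm_mul, h1, mul_one, mul_pow]
  have hψm : Measurable fun y => ‖ψ y‖ₑ ^ 2 := (hsm.measurable.enorm).pow_const 2
  have hφm : Measurable fun q : Config N × Config N => ‖φ (q.1 - q.2)‖ₑ ^ 2 :=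
    ((φ.continuous.comp (continuous_fst.sub continuous_snd)).measurable.enorm).pow_const 2
  rw [Measure.volume_eq_prod, lintegral_prod _ (hU.measurable.enorm.pow_const 2).aemeasurable]
  have hin : ∀ x : Config N, ∫⁻ p : Config N, ‖wavePacketIntegral ħ φ ψ (x, p)‖ₑ ^ 2 =
      ∫⁻ y, ‖ψ y‖ₑ ^ 2 * ‖φ (x - y)‖ₑ ^ 2 := by
    intro x
    simp_rw [hpt]
    rw [lintegral_const_mul' _ _ (by simp),
      lintegral_fourier_scaled hħ (integrable_mul_translate φ hψ x)
      (memLp_mul_translate φ hψ x), ← mul_assoc, hcd, one_mul]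
    simp_rw [enorm_mul, mul_pow]
  simp_rw [hin]
  rw [lintegral_lintegral_swap
    (((hψm.comp measurable_snd).mul hφm).aemeasurable)]
  have hy : ∀ y : Config N, ∫⁻ x, ‖ψ y‖ₑ ^ 2 * ‖φ (x - y)‖ₑ ^ 2 =
      ‖ψ y‖ₑ ^ 2 * ∫⁻ x, ‖φ x‖ₑ ^ 2 := by
    intro y
    rw [lintegral_const_mul' _ _ (by simp),
      lintegral_sub_right_eq_self (fun x => ‖φ x‖ₑ ^ 2) y]
  simp_rw [hy]
  rw [lintegral_mul_const _ hψm]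

theorem enorm_sq_toLp_two {α : Type} [MeasurableSpace α] {μ : Measure α} {f : α → ℂ}
    (hf : MemLp f 2 μ) : ‖hf.toLp f‖ₑ ^ 2 = ∫⁻ a, ‖f a‖ₑ ^ 2 ∂μ := by
  rw [Lp.enorm_def, eLpNorm_congr_ae hf.coeFn_toLp,
    eLpNorm_eq_lintegral_rpow_enorm_toReal (by norm_num) (by norm_num), ← ENNReal.rpow_natCast,
    ← ENNReal.rpow_mul]
  simp

theorem wavePacketTransform_apply {N : ℕ} {ħ : ℝ} (hħ : 0 < ħ) (φ : 𝓢(Config N, ℂ))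
    (ψ : Lp ℂ 2 (volume : Measure (Config N))) :
    wavePacketTransform ħ hħ φ ψ =
      (memLp_wavePacketIntegral hħ φ ψ).toLp (wavePacketIntegral ħ φ ψ) := rfl

theorem norm_toLp_two_sq {α : Type} [MeasurableSpace α] {μ : Measure α} {f : α → ℂ}
    (hf : MemLp f 2 μ) : ‖hf.toLp f‖ ^ 2 = (∫⁻ a, ‖f a‖ₑ ^ 2 ∂μ).toReal := by
  rw [← enorm_sq_toLp_two hf, ← ofReal_norm, ← ENNReal.ofReal_pow (norm_nonneg _),
    ENNReal.toReal_ofReal (by positivity)]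

theorem norm_wavePacketTransform {N : ℕ} {ħ : ℝ} (hħ : 0 < ħ) {φ : 𝓢(Config N, ℂ)}
    (hφ : ‖φ.toLp 2‖ = 1) (ψ : Lp ℂ 2 (volume : Measure (Config N))) :
    ‖wavePacketTransform ħ hħ φ ψ‖ = ‖ψ‖ := by
  have h1 : (∫⁻ y, ‖φ y‖ₑ ^ 2).toReal = 1 := by
    have e : φ.toLp 2 = (φ.memLp 2 volume).toLp φ := rfl
    rw [← norm_toLp_two_sq (φ.memLp 2 volume), ← e, hφ, one_pow]
  have h2 : ‖ψ‖ ^ 2 = (∫⁻ y, ‖ψ y‖ₑ ^ 2).toReal := by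
    rw [← norm_toLp_two_sq (Lp.memLp ψ), Lp.toLp_coeFn]
  have h3 : ‖wavePacketTransform ħ hħ φ ψ‖ ^ 2 = ‖ψ‖ ^ 2 := by
    rw [wavePacketTransform_apply, norm_toLp_two_sq, lintegral_enorm_sq_wavePacketIntegral hħ,
      ENNReal.toReal_mul, h1, mul_one, h2]
  exact (sq_eq_sq₀ (norm_nonneg _) (norm_nonneg _)).1 h3

/-- The wave-packet transform of a normalized window as a linear isometry. -/
def wavePacketIsometry {N : ℕ} {ħ : ℝ} (hħ : 0 < ħ) {φ : 𝓢(Config N, ℂ)}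
    (hφ : ‖φ.toLp 2‖ = 1) :
    Lp ℂ 2 (volume : Measure (Config N)) →ₗᵢ[ℂ] Lp ℂ 2 (volume : Measure (Phase N)) where
  toLinearMap := wavePacketTransform ħ hħ φ
  norm_map' := norm_wavePacketTransform hħ hφ

theorem integrable_rexp_neg_mul_sq_norm {V : Type} [NormedAddCommGroup V]
    [InnerProductSpace ℝ V] [FiniteDimensional ℝ V] [MeasurableSpace V] [BorelSpace V]
    {b : ℝ} (hb : 0 < b) : Integrable fun v : V => Real.exp (-b * ‖v‖ ^ 2) := by
  have := (GaussianFourier.integrable_cexp_neg_mul_sq_norm_add (V := V)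
    (b := (b : ℂ)) (by simpa using hb) 0 0).norm
  refine this.congr (ae_of_all _ fun v => ?_)
  simp only [inner_zero_left, Complex.ofReal_zero, mul_zero, add_zero]
  rw [Complex.norm_exp]
  norm_cast

theorem norm_standardGaussian (N : ℕ) {ħ : ℝ} (hħ : 0 < ħ) :
    ‖(standardGaussian N ħ hħ).toLp 2‖ = 1 := by
  have h : ‖(standardGaussian N ħ hħ).toLp 2‖ₑ ^ 2 = 1 := by
    refine (enorm_sq_toLp_two ((standardGaussian N ħ hħ).memLp 2 volume)).trans ?_
    have hi := integrable_rexp_neg_mul_sq_norm (V := Config N) (b := 1 / ħ) (by positivity)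
    have e : ∀ v : Config N, ‖standardGaussian N ħ hħ v‖ₑ ^ 2 =
        ENNReal.ofReal ((1 / (Real.pi * ħ)) ^ ((N : ℝ) / 2) * Real.exp (-(1 / ħ) * ‖v‖ ^ 2)) := by
      intro v
      rw [← ofReal_norm, ← ENNReal.ofReal_pow (norm_nonneg _)]
      congr 1
      change ‖((((1 / (Real.pi * ħ)) ^ ((N : ℝ) / 4) *
        Real.exp (-(1 / (2 * ħ)) * ‖v‖ ^ 2) : ℝ)) : ℂ)‖ ^ 2 = _
      rw [Complex.norm_real, Real.norm_eq_abs, sq_abs, mul_pow, ← Real.exp_nat_mul,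
        ← Real.rpow_natCast, ← Real.rpow_mul (by positivity)]
      congr 2
      · push_cast; ring
      · push_cast; field_simp
    simp_rw [e]
    rw [← ofReal_integral_eq_lintegral_ofReal (hi.const_mul _) (ae_of_all _ fun v => by positivity),
      integral_const_mul, GaussianFourier.integral_rexp_neg_mul_sq_norm (by positivity),
      finrank_euclideanSpace, Fintype.card_fin, ← Real.mul_rpow (by positivity) (by positivity)]
    have : 1 / (Real.pi * ħ) * (Real.pi / (1 / ħ)) = 1 := by field_simp
    rw [this]
    simp
  rw [← ofReal_norm, ← ENNReal.ofReal_pow (norm_nonneg _), ENNReal.ofReal_eq_one] at h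
  exact (pow_eq_one_iff_of_nonneg (norm_nonneg _) two_ne_zero).1 h

/-! ### Gaussian exponentials on phase space. -/

/-- The squared Euclidean norm `|z|² = |x|² + |p|²` on phase space. -/
def phaseSq {N : ℕ} (z : Phase N) : ℝ := ‖z.1‖ ^ 2 + ‖z.2‖ ^ 2

/-- The complex coordinate `x_j + i p_j`. -/
def coord {N : ℕ} (j : Fin N) : Phase N →L[ℝ] ℂ :=
  Complex.ofRealCLM ∘L EuclideanSpace.proj j ∘L ContinuousLinearMap.fst ℝ _ _ +
    Complex.I • (Complex.ofRealCLM ∘L EuclideanSpace.proj j ∘L ContinuousLinearMap.snd ℝ _ _)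

/-- The conjugate coordinate `x_j - i p_j`. -/
def conjCoord {N : ℕ} (j : Fin N) : Phase N →L[ℝ] ℂ :=
  Complex.ofRealCLM ∘L EuclideanSpace.proj j ∘L ContinuousLinearMap.fst ℝ _ _ -
    Complex.I • (Complex.ofRealCLM ∘L EuclideanSpace.proj j ∘L ContinuousLinearMap.snd ℝ _ _)

theorem coord_apply {N : ℕ} (j : Fin N) (z : Phase N) :
    coord j z = (z.1 j : ℂ) + Complex.I * (z.2 j : ℂ) := rfl

theorem conjCoord_apply {N : ℕ} (j : Fin N) (z : Phase N) :
    conjCoord j z = (z.1 j : ℂ) - Complex.I * (z.2 j : ℂ) := rfl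

theorem norm_coord_le {N : ℕ} (j : Fin N) (z : Phase N) : ‖coord j z‖ ≤ ‖z.1‖ + ‖z.2‖ := by
  rw [coord_apply]
  refine (norm_add_le _ _).trans ?_
  rw [norm_mul, Complex.norm_I, one_mul, Complex.norm_real, Complex.norm_real]
  exact add_le_add (PiLp.norm_apply_le _ _) (PiLp.norm_apply_le _ _)

theorem norm_conjCoord_le {N : ℕ} (j : Fin N) (z : Phase N) :
    ‖conjCoord j z‖ ≤ ‖z.1‖ + ‖z.2‖ := by
  rw [conjCoord_apply]
  refine (norm_sub_le _ _).trans ?_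
  rw [norm_mul, Complex.norm_I, one_mul, Complex.norm_real, Complex.norm_real]
  exact add_le_add (PiLp.norm_apply_le _ _) (PiLp.norm_apply_le _ _)

theorem contDiff_phaseSq {N : ℕ} : ContDiff ℝ ∞ (phaseSq (N := N)) :=
  (contDiff_fst.norm_sq ℝ).add (contDiff_snd.norm_sq ℝ)

/-- The function `exp(-a|z|² + Σ α_j (x_j - i p_j) + Σ β_j (x_j + i p_j))`. -/
def phaseExp {N : ℕ} (a : ℝ) (α β : Fin N → ℂ) (z : Phase N) : ℂ :=
  Complex.exp (-(a : ℂ) * (phaseSq z : ℂ) + ∑ j, α j * conjCoord j z + ∑ j, β j * coord j z)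

theorem contDiff_phaseExp {N : ℕ} (a : ℝ) (α β : Fin N → ℂ) :
    ContDiff ℝ ∞ (phaseExp a α β) := by
  have h : ContDiff ℝ ∞ fun z : Phase N => (phaseSq z : ℂ) :=
    Complex.ofRealCLM.contDiff.comp contDiff_phaseSq
  have h1 : ContDiff ℝ ∞ fun z : Phase N => ∑ j, α j * conjCoord j z :=
    ContDiff.sum fun j _ => contDiff_const.mul (conjCoord j).contDiff
  have h2 : ContDiff ℝ ∞ fun z : Phase N => ∑ j, β j * coord j z :=
    ContDiff.sum fun j _ => contDiff_const.mul (coord j).contDiff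
  exact (((contDiff_const.mul h).add h1).add h2).cexp

theorem phaseExp_mul {N : ℕ} (a a' : ℝ) (α α' β β' : Fin N → ℂ) (z : Phase N) :
    phaseExp a α β z * phaseExp a' α' β' z = phaseExp (a + a') (α + α') (β + β') z := by
  simp only [phaseExp, ← Complex.exp_add, Pi.add_apply, add_mul, Finset.sum_add_distrib]
  congr 1
  push_cast
  ring

theorem phaseExp_zero {N : ℕ} (a : ℝ) (z : Phase N) :
    phaseExp a 0 0 z = (Real.exp (-a * phaseSq z) : ℂ) := by
  simp [phaseExp]

theorem phaseExp_ne_zero {N : ℕ} (a : ℝ) (α β : Fin N → ℂ) (z : Phase N) :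
    phaseExp a α β z ≠ 0 := Complex.exp_ne_zero _

theorem norm_sum_coord_le {N : ℕ} {α β : Fin N → ℂ} {C : ℝ} (hC : ∑ j, ‖α j‖ + ∑ j, ‖β j‖ ≤ C)
    (z : Phase N) :
    ‖∑ j, α j * conjCoord j z‖ + ‖∑ j, β j * coord j z‖ ≤ C * (‖z.1‖ + ‖z.2‖) := by
  have h1 : ‖∑ j, α j * conjCoord j z‖ ≤ (∑ j, ‖α j‖) * (‖z.1‖ + ‖z.2‖) := by
    rw [Finset.sum_mul]
    refine norm_sum_le_of_le _ fun j _ => ?_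
    rw [norm_mul]
    gcongr
    exact norm_conjCoord_le j z
  have h2 : ‖∑ j, β j * coord j z‖ ≤ (∑ j, ‖β j‖) * (‖z.1‖ + ‖z.2‖) := by
    rw [Finset.sum_mul]
    refine norm_sum_le_of_le _ fun j _ => ?_
    rw [norm_mul]
    gcongr
    exact norm_coord_le j z
  calc _ ≤ (∑ j, ‖α j‖ + ∑ j, ‖β j‖) * (‖z.1‖ + ‖z.2‖) := by rw [add_mul]; exact add_le_add h1 h2
    _ ≤ _ := by gcongr

theorem norm_phaseExp_le {N : ℕ} (a : ℝ) {α β : Fin N → ℂ} {C : ℝ}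
    (hC : ∑ j, ‖α j‖ + ∑ j, ‖β j‖ ≤ C) (z : Phase N) :
    ‖phaseExp a α β z‖ ≤ Real.exp (-a * phaseSq z + C * (‖z.1‖ + ‖z.2‖)) := by
  rw [phaseExp, Complex.norm_exp]
  refine Real.exp_le_exp.2 ?_
  have h := norm_sum_coord_le hC z
  have h1 := Complex.re_le_norm (∑ j, α j * conjCoord j z)
  have h2 := Complex.re_le_norm (∑ j, β j * coord j z)
  have h3 : (-(a : ℂ) * (phaseSq z : ℂ)).re = -a * phaseSq z := by norm_cast
  rw [Complex.add_re, Complex.add_re, h3]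
  linarith

/-- Half of the Gaussian absorbs the linear term, by completing the square separately in `‖x‖` and
`‖p‖`; each contributes `C²/(2a)`. -/
theorem exp_neg_phaseSq_add_le {N : ℕ} {a : ℝ} (ha : 0 < a) (C : ℝ) (z : Phase N) :
    Real.exp (-a * phaseSq z + C * (‖z.1‖ + ‖z.2‖)) ≤
      Real.exp (C ^ 2 / a) * Real.exp (-(a / 2) * phaseSq z) := by
  rw [← Real.exp_add]
  refine Real.exp_le_exp.2 ?_
  have key : ∀ t : ℝ, C * t ≤ a / 2 * t ^ 2 + C ^ 2 / (2 * a) := by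
    intro t
    have h : a / 2 * t ^ 2 + C ^ 2 / (2 * a) - C * t = (a * t - C) ^ 2 / (2 * a) := by
      field_simp; ring
    have : 0 ≤ (a * t - C) ^ 2 / (2 * a) := by positivity
    linarith
  have h1 := key ‖z.1‖
  have h2 := key ‖z.2‖
  have h3 : C ^ 2 / a = C ^ 2 / (2 * a) + C ^ 2 / (2 * a) := by field_simp; ring
  rw [h3, phaseSq]
  linarith

theorem memLp_exp_neg_phaseSq {N : ℕ} {a : ℝ} (ha : 0 < a) :
    MemLp (fun z : Phase N => Real.exp (-a * phaseSq z)) 2 := by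
  have hc : Continuous fun z : Phase N => Real.exp (-a * phaseSq z) :=
    (continuous_const.mul contDiff_phaseSq.continuous).rexp
  rw [memLp_two_iff_integrable_sq hc.aestronglyMeasurable, Measure.volume_eq_prod]
  have hi := integrable_rexp_neg_mul_sq_norm (V := Config N) (b := 2 * a) (by positivity)
  refine (hi.mul_prod hi).congr (ae_of_all _ fun z => ?_)
  simp only [phaseSq]
  rw [← Real.exp_add, ← Real.exp_nat_mul]
  congr 1
  push_cast
  ring

theorem memLp_of_norm_le_exp_neg_phaseSq {N : ℕ} {a : ℝ} (ha : 0 < a) {K : ℝ} {f : Phase N → ℂ}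
    (hf : Continuous f) (h : ∀ z, ‖f z‖ ≤ K * Real.exp (-a * phaseSq z)) : MemLp f 2 :=
  ((memLp_exp_neg_phaseSq ha).const_mul K).mono hf.aestronglyMeasurable
    (ae_of_all _ fun z => (h z).trans (le_abs_self _))

theorem memLp_phaseExp {N : ℕ} {a : ℝ} (ha : 0 < a) (α β : Fin N → ℂ) :
    MemLp (phaseExp a α β) 2 :=
  memLp_of_norm_le_exp_neg_phaseSq (half_pos ha) (contDiff_phaseExp a α β).continuous fun z =>
    (norm_phaseExp_le a le_rfl z).trans (exp_neg_phaseSq_add_le ha _ z)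

/-- Since `|w_j| ≤ exp(‖x‖ + ‖p‖)`, a coordinate factor only raises the linear rate from `C` to `C +
1`. -/
theorem norm_conjCoord_mul_phaseExp_le {N : ℕ} {a : ℝ} {α β : Fin N → ℂ} {C : ℝ}
    (hC : ∑ j, ‖α j‖ + ∑ j, ‖β j‖ ≤ C) (j : Fin N) (z : Phase N) :
    ‖conjCoord j z * phaseExp a α β z‖ ≤
      Real.exp (-a * phaseSq z + (C + 1) * (‖z.1‖ + ‖z.2‖)) := by
  rw [norm_mul]
  calc _ ≤ Real.exp (‖z.1‖ + ‖z.2‖) * Real.exp (-a * phaseSq z + C * (‖z.1‖ + ‖z.2‖)) := by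
        gcongr
        · have := Real.add_one_le_exp (‖z.1‖ + ‖z.2‖)
          linarith [norm_conjCoord_le j z]
        · exact norm_phaseExp_le a hC z
    _ = _ := by rw [← Real.exp_add]; congr 1; ring

theorem memLp_conjCoord_mul_phaseExp {N : ℕ} {a : ℝ} (ha : 0 < a) (α β : Fin N → ℂ)
    (j : Fin N) : MemLp (fun z => conjCoord j z * phaseExp a α β z) 2 :=
  memLp_of_norm_le_exp_neg_phaseSq (half_pos ha)
    ((conjCoord j).continuous.mul (contDiff_phaseExp a α β).continuous) fun z =>
    (norm_conjCoord_mul_phaseExp_le le_rfl j z).trans (exp_neg_phaseSq_add_le ha _ z)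

/-! ### The Cauchy-Riemann operator. -/

/-- The Cauchy-Riemann derivative `∂χ/∂x_j - i ∂χ/∂p_j`. -/
def crDeriv {N : ℕ} (j : Fin N) (χ : Phase N → ℂ) (z : Phase N) : ℂ :=
  fderiv ℝ χ z (EuclideanSpace.single j 1, 0) -
    Complex.I * fderiv ℝ χ z (0, EuclideanSpace.single j 1)

theorem crDeriv_mul {N : ℕ} (j : Fin N) {f g : Phase N → ℂ} {z : Phase N}
    (hf : DifferentiableAt ℝ f z) (hg : DifferentiableAt ℝ g z) :
    crDeriv j (fun z => f z * g z) z = f z * crDeriv j g z + crDeriv j f z * g z := by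
  simp only [crDeriv]
  rw [fderiv_fun_mul hf hg]
  simp only [add_apply, smul_apply, smul_eq_mul]
  ring

theorem continuous_crDeriv {N : ℕ} (j : Fin N) {f : Phase N → ℂ} (hf : ContDiff ℝ ∞ f) :
    Continuous (crDeriv j f) := by
  have := hf.continuous_fderiv (by simp)
  unfold crDeriv
  fun_prop

theorem hasCompactSupport_crDeriv {N : ℕ} (j : Fin N) {f : Phase N → ℂ}
    (hf : HasCompactSupport f) : HasCompactSupport (crDeriv j f) :=
  (hf.fderiv (𝕜 := ℝ)).mono fun z hz h => hz (by simp [crDeriv, h])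

/-- The operator sends `w̄_j` to `0`, `w_j` to `2` and `|z|²` to `2 w̄_j`, so `α` leaves no trace in
the factor. -/
theorem crDeriv_phaseExp {N : ℕ} (a : ℝ) (α β : Fin N → ℂ) (j : Fin N) (z : Phase N) :
    crDeriv j (phaseExp a α β) z =
      (2 * β j - 2 * a * conjCoord j z) * phaseExp a α β z := by
  have h0 : HasFDerivAt (fun z : Phase N => (phaseSq z : ℂ)) _ z :=
    Complex.ofRealCLM.hasFDerivAt.comp z
      ((hasFDerivAt_fst (𝕜 := ℝ) (p := z)).norm_sq.add (hasFDerivAt_snd (𝕜 := ℝ) (p := z)).norm_sq)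
  have h1 : HasFDerivAt (fun z : Phase N => ∑ j, α j * conjCoord j z) _ z :=
    HasFDerivAt.fun_sum fun j _ => ((conjCoord j).hasFDerivAt.const_mul (α j))
  have h2 : HasFDerivAt (fun z : Phase N => ∑ j, β j * coord j z) _ z :=
    HasFDerivAt.fun_sum fun j _ => ((coord j).hasFDerivAt.const_mul (β j))
  have h : HasFDerivAt (phaseExp a α β) _ z := (((h0.const_mul (-(a : ℂ))).add h1).add h2).cexp
  have hs : ∀ γ : Fin N → ℂ, ∑ i, γ i * (((if i = j then 1 else 0 : ℝ)) : ℂ) = γ j := by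
    intro γ
    simp [apply_ite Complex.ofReal]
  have hs' : ∀ γ : Fin N → ℂ,
      ∑ i, γ i * (Complex.I * (((if i = j then 1 else 0 : ℝ)) : ℂ)) = γ j * Complex.I := by
    intro γ
    simp [apply_ite Complex.ofReal]
  simp only [crDeriv, h.fderiv]
  simp [conjCoord_apply, coord_apply, PiLp.single_apply, phaseExp,
    EuclideanSpace.inner_single_right, hs, hs']
  set E := Complex.exp (-(↑a * ↑(phaseSq z)) + ∑ j, α j * (↑(z.1.ofLp j) -
    Complex.I * ↑(z.2.ofLp j)) + ∑ j, β j * (↑(z.1.ofLp j) + Complex.I * ↑(z.2.ofLp j)))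
  linear_combination E * (α j - β j) * Complex.I_sq

/-! ### Gaussian packets and their transforms. -/

/-- The Gaussian packet `exp(-|y|²/(2ħ) + γ·y)`. -/
def gaussianPacket {N : ℕ} (ħ : ℝ) (γ : Fin N → ℂ) (y : Config N) : ℂ :=
  Complex.exp (-((1 / (2 * ħ) : ℝ) : ℂ) * ((‖y‖ ^ 2 : ℝ) : ℂ) + ∑ j, γ j * (y j : ℂ))

theorem continuous_gaussianPacket {N : ℕ} (ħ : ℝ) (γ : Fin N → ℂ) :
    Continuous (gaussianPacket ħ γ) := by
  unfold gaussianPacket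
  fun_prop

theorem memLp_gaussianPacket {N : ℕ} {ħ : ℝ} (hħ : 0 < ħ) (γ : Fin N → ℂ) :
    MemLp (gaussianPacket ħ γ) 2 := by
  rw [memLp_two_iff_integrable_sq_norm (continuous_gaussianPacket ħ γ).aestronglyMeasurable]
  set C := ∑ j, ‖γ j‖
  have hi := (integrable_rexp_neg_mul_sq_norm (V := Config N) (b := 1 / (2 * ħ))
    (by positivity)).const_mul (Real.exp (2 * ħ * C ^ 2))
  refine hi.mono' ((continuous_gaussianPacket ħ γ).norm.pow 2).aestronglyMeasurable
    (ae_of_all _ fun y => ?_)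
  have h1 : (∑ j, γ j * (y j : ℂ)).re ≤ C * ‖y‖ := by
    refine (Complex.re_le_norm _).trans ?_
    rw [Finset.sum_mul]
    refine norm_sum_le_of_le _ fun j _ => ?_
    rw [norm_mul, Complex.norm_real]
    gcongr
    exact PiLp.norm_apply_le _ _
  rw [Real.norm_of_nonneg (by positivity), gaussianPacket, Complex.norm_exp, ← Real.exp_nat_mul,
    ← Real.exp_add]
  refine Real.exp_le_exp.2 ?_
  have h3 : (-((1 / (2 * ħ) : ℝ) : ℂ) * ((‖y‖ ^ 2 : ℝ) : ℂ)).re = -(1 / (2 * ħ)) * ‖y‖ ^ 2 := by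
    norm_cast
  rw [Complex.add_re, h3]
  have h4 : 2 * ħ * C ^ 2 + 1 / (2 * ħ) * ‖y‖ ^ 2 - 2 * (C * ‖y‖) =
      (2 * ħ * C - ‖y‖) ^ 2 / (2 * ħ) := by field_simp; ring
  have h5 : 0 ≤ (2 * ħ * C - ‖y‖) ^ 2 / (2 * ħ) := by positivity
  push_cast
  linarith

theorem integral_cexp_neg_mul_normSq_add_sum {N : ℕ} {b : ℂ} (hb : 0 < b.re) (c : Fin N → ℂ) :
    ∫ y : Config N, Complex.exp (-b * ((‖y‖ ^ 2 : ℝ) : ℂ) + ∑ j, c j * (y j : ℂ)) =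
      (Real.pi / b) ^ ((N : ℂ) / 2) * Complex.exp ((∑ j, c j ^ 2) / (4 * b)) := by
  have h := GaussianFourier.integral_cexp_neg_mul_sum_add hb c
  rw [Fintype.card_fin] at h
  rw [← h, ← (PiLp.volume_preserving_toLp (Fin N)).integral_comp
    (MeasurableEquiv.toLp 2 _).measurableEmbedding]
  simp [EuclideanSpace.real_norm_sq_eq]

/-- The integrand is Gaussian in `y` with quadratic coefficient `1/ħ` and linear coefficient `γ +
w̄/ħ`, so the Gaussian integral formula gives the result in closed form. -/
theorem wavePacketIntegral_gaussianPacket {N : ℕ} {ħ : ℝ} (hħ : 0 < ħ) (γ : Fin N → ℂ) :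
    ∃ C : ℂ, C ≠ 0 ∧ ∀ z, wavePacketIntegral ħ (standardGaussian N ħ hħ) (gaussianPacket ħ γ) z =
      C * phaseExp (1 / (4 * ħ)) (fun j => γ j / 2) 0 z := by
  have hħ' : (ħ : ℂ) ≠ 0 := by exact_mod_cast hħ.ne'
  have hπ : (Real.pi : ℂ) ≠ 0 := by exact_mod_cast Real.pi_ne_zero
  set c₀ : ℂ := (((1 / (2 * Real.pi * ħ)) ^ ((N : ℝ) / 2) : ℝ) : ℂ) with hc₀
  set c₁ : ℂ := (((1 / (Real.pi * ħ)) ^ ((N : ℝ) / 4) : ℝ) : ℂ) with hc₁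
  set c₂ : ℂ := (Real.pi / (1 / ħ : ℂ)) ^ ((N : ℂ) / 2) with hc₂
  have h0 : c₀ ≠ 0 := by
    rw [hc₀, Complex.ofReal_ne_zero]
    positivity
  have h1 : c₁ ≠ 0 := by
    rw [hc₁, Complex.ofReal_ne_zero]
    positivity
  have h2 : c₂ ≠ 0 := by
    rw [hc₂, Complex.cpow_ne_zero_iff]
    exact Or.inl (div_ne_zero hπ (one_div_ne_zero hħ'))
  refine ⟨c₀ * c₁ * c₂ * Complex.exp (∑ j, ħ / 4 * γ j ^ 2),
    by simp [h0, h1, h2], fun z => ?_⟩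
  have hint : ∀ y : Config N, Complex.exp (-(Complex.I / ħ) * (inner ℝ z.2 y : ℝ)) *
      (gaussianPacket ħ γ y * standardGaussian N ħ hħ (z.1 - y)) =
      c₁ * Complex.exp (-(1 / (2 * ħ)) * ((‖z.1‖ ^ 2 : ℝ) : ℂ)) *
        Complex.exp (-(1 / ħ : ℂ) * ((‖y‖ ^ 2 : ℝ) : ℂ) +
          ∑ j, (γ j + conjCoord j z / ħ) * (y j : ℂ)) := by
    intro y
    change Complex.exp (-(Complex.I / ħ) * (inner ℝ z.2 y : ℝ)) * (Complex.exp _ *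
      ((((1 / (Real.pi * ħ)) ^ ((N : ℝ) / 4) *
        Real.exp (-(1 / (2 * ħ)) * ‖z.1 - y‖ ^ 2) : ℝ)) : ℂ)) = _
    rw [Complex.ofReal_mul, ← hc₁, Complex.ofReal_exp, mul_left_comm (Complex.exp _) c₁,
      mul_left_comm (Complex.exp _) c₁, mul_assoc, ← Complex.exp_add, ← Complex.exp_add,
      ← Complex.exp_add]
    congr 2
    rw [norm_sub_sq_real]
    simp only [PiLp.inner_apply, conjCoord_apply, add_mul, div_mul_eq_mul_div, sub_mul,
      Finset.sum_add_distrib, Finset.sum_sub_distrib, ← Finset.sum_div]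
    simp only [RCLike.inner_apply, conj_trivial]
    push_cast
    have e : ∑ x, Complex.I * (z.2 x : ℂ) * (y x : ℂ) = Complex.I * ∑ x, (y x : ℂ) * (z.2 x : ℂ) := by
      rw [Finset.mul_sum]
      exact Finset.sum_congr rfl fun _ _ => by ring
    have e' : ∑ x, (z.1 x : ℂ) * (y x : ℂ) = ∑ x, (y x : ℂ) * (z.1 x : ℂ) :=
      Finset.sum_congr rfl fun _ _ => by ring
    rw [e, e']
    field_simp
    ring
  rw [wavePacketIntegral]
  simp_rw [hint]
  rw [integral_const_mul, integral_cexp_neg_mul_normSq_add_sum (by simpa using hħ), ← hc₀, ← hc₂,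
    phaseExp]
  -- The term `w̄_j²/(4ħ)` of the expanded square contains `-i x_j p_j/(2ħ)`, which the phase
  -- prefactor cancels. Together with `-|x|²/(2ħ)` the rest is `-|z|²/(4ħ)`.
  have hexp : Complex.I / (2 * ħ) * (inner ℝ z.2 z.1 : ℝ) + (-(1 / (2 * ħ)) *
      ((‖z.1‖ ^ 2 : ℝ) : ℂ) + (∑ j, (γ j + conjCoord j z / ħ) ^ 2) / (4 * (1 / ħ))) =
      (∑ j, ħ / 4 * γ j ^ 2) + (-((1 / (4 * ħ) : ℝ) : ℂ) * (phaseSq z : ℂ) +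
        ∑ j, γ j / 2 * conjCoord j z + ∑ j, (0 : Fin N → ℂ) j * coord j z) := by
    simp only [PiLp.inner_apply, phaseSq, EuclideanSpace.real_norm_sq_eq, RCLike.inner_apply,
      conj_trivial, Pi.zero_apply, zero_mul, Finset.sum_const_zero, add_zero, conjCoord_apply,
      ← Finset.sum_add_distrib]
    push_cast
    simp only [Finset.mul_sum, Finset.sum_div, ← Finset.sum_add_distrib]
    refine Finset.sum_congr rfl fun j _ => ?_
    field_simp
    linear_combination (2 * (z.2 j : ℂ) ^ 2) * Complex.I_sq
  rw [mul_assoc _ (Complex.exp (∑ j, ħ / 4 * γ j ^ 2)), ← Complex.exp_add, ← hexp, Complex.exp_add,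
    Complex.exp_add]
  ring

theorem wavePacketIntegral_congr {N : ℕ} (ħ : ℝ) (φ : Config N → ℂ) {ψ ψ' : Config N → ℂ}
    (h : ψ =ᵐ[volume] ψ') : wavePacketIntegral ħ φ ψ = wavePacketIntegral ħ φ ψ' := by
  funext z
  unfold wavePacketIntegral
  congr 1
  refine integral_congr_ae ?_
  filter_upwards [h] with y hy
  rw [hy]

theorem wavePacketTransform_gaussianPacket {N : ℕ} {ħ : ℝ} (hħ : 0 < ħ) (γ : Fin N → ℂ) :
    ∃ C : ℂ, C ≠ 0 ∧ wavePacketTransform ħ hħ (standardGaussian N ħ hħ)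
      ((memLp_gaussianPacket hħ γ).toLp _) =ᵐ[volume]
        fun z => C * phaseExp (1 / (4 * ħ)) (fun j => γ j / 2) 0 z := by
  obtain ⟨C, hC, h⟩ := wavePacketIntegral_gaussianPacket hħ γ
  refine ⟨C, hC, ?_⟩
  rw [wavePacketTransform_apply]
  filter_upwards [(memLp_wavePacketIntegral hħ (standardGaussian N ħ hħ)
    ((memLp_gaussianPacket hħ γ).toLp _)).coeFn_toLp] with z hz
  rw [hz, wavePacketIntegral_congr ħ _ (memLp_gaussianPacket hħ γ).coeFn_toLp, h]

theorem inner_toLp_left {α : Type} [MeasurableSpace α] {μ : Measure α} {f : α → ℂ}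
    (hf : MemLp f 2 μ) (g : Lp ℂ 2 μ) :
    inner ℂ (hf.toLp f) g = ∫ a, (starRingEnd ℂ) (f a) * g a ∂μ := by
  rw [L2.inner_def]
  refine integral_congr_ae ?_
  filter_upwards [hf.coeFn_toLp] with a ha
  rw [ha, RCLike.inner_apply, mul_comm]

theorem inner_toLp_right {α : Type} [MeasurableSpace α] {μ : Measure α} {f : α → ℂ}
    (hf : MemLp f 2 μ) (g : Lp ℂ 2 μ) :
    inner ℂ g (hf.toLp f) = ∫ a, (starRingEnd ℂ) (g a) * f a ∂μ := by
  rw [L2.inner_def]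
  refine integral_congr_ae ?_
  filter_upwards [hf.coeFn_toLp] with a ha
  rw [ha, RCLike.inner_apply, mul_comm]

/-- Density of the packets: for `γ = -iξ` the inner products are the Fourier transform of `κ̄
exp(-|y|²/(2ħ))`, and the Gaussian never vanishes. -/
theorem eq_zero_of_inner_gaussianPacket {N : ℕ} {ħ : ℝ} (hħ : 0 < ħ)
    {κ : Lp ℂ 2 (volume : Measure (Config N))}
    (h : ∀ γ : Fin N → ℂ, inner ℂ κ ((memLp_gaussianPacket hħ γ).toLp _) = 0) : κ = 0 := by
  have hκ : MemLp (fun y => (starRingEnd ℂ) (κ y)) 2 := (Lp.memLp κ).star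
  have hb : MemLp (gaussianPacket (N := N) ħ 0) ⊤ := by
    refine memLp_top_of_bound (continuous_gaussianPacket ħ 0).aestronglyMeasurable 1
      (ae_of_all _ fun y => ?_)
    have : (-((1 / (2 * ħ) : ℝ) : ℂ) * ((‖y‖ ^ 2 : ℝ) : ℂ)).re = -(1 / (2 * ħ) * ‖y‖ ^ 2) := by
      rw [← neg_mul]
      norm_cast
    rw [gaussianPacket, Complex.norm_exp, Real.exp_le_one_iff]
    simp only [Pi.zero_apply, zero_mul, Finset.sum_const_zero, add_zero]
    rw [this, neg_nonpos]
    positivity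
  have key : (fun y => (starRingEnd ℂ) (κ y) * gaussianPacket ħ 0 y) =ᵐ[volume] 0 := by
    refine ae_eq_zero_of_integral_mul_cexp_inner
      (hκ.integrable_mul (memLp_gaussianPacket hħ 0)) (hb.mul' hκ) fun ξ => ?_
    rw [← h fun j => -(Complex.I * (ξ j : ℂ)), inner_toLp_right]
    congr 1
    funext y
    rw [mul_assoc, gaussianPacket, gaussianPacket, ← Complex.exp_add]
    congr 2
    simp only [Pi.zero_apply, zero_mul, Finset.sum_const_zero, add_zero, neg_mul,
      Finset.sum_neg_distrib, PiLp.inner_apply, RCLike.inner_apply, conj_trivial]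
    push_cast
    rw [Finset.mul_sum]
    congr 2
    exact Finset.sum_congr rfl fun _ _ => by ring
  rw [Lp.eq_zero_iff_ae_eq_zero]
  filter_upwards [key] with y hy
  simpa [gaussianPacket] using hy

/-! ### The range satisfies the Cauchy-Riemann equations. -/

theorem integral_mul_crDeriv_eq_zero {N : ℕ} (j : Fin N) {f χ : Phase N → ℂ}
    (hf : ContDiff ℝ ∞ f) (hf0 : ∀ z, crDeriv j f z = 0) (hχ : ContDiff ℝ ∞ χ)
    (hc : HasCompactSupport χ) : ∫ z, f z * crDeriv j χ z = 0 := by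
  have hi : ∀ v : Phase N, Integrable fun z => f z * fderiv ℝ χ z v := fun v => by
    have := hχ.continuous_fderiv (by simp)
    refine Continuous.integrable_of_hasCompactSupport (hf.continuous.mul (by fun_prop)) ?_
    exact HasCompactSupport.mul_left ((hc.fderiv (𝕜 := ℝ)).mono fun z hz h => hz (by simp [h]))
  have hi' : ∀ v : Phase N, Integrable fun z => fderiv ℝ f z v * χ z := fun v => by
    have := hf.continuous_fderiv (by simp)
    have h2 := hχ.continuous
    exact Continuous.integrable_of_hasCompactSupport (by fun_prop) hc.mul_left
  have hi0 : Integrable fun z => f z * χ z :=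
    Continuous.integrable_of_hasCompactSupport (hf.continuous.mul hχ.continuous) hc.mul_left
  have : (volume : Measure (Phase N)).IsAddHaarMeasure :=
    Measure.prod.instIsAddHaarMeasure _ _
  have hp : ∀ v : Phase N, ∫ z, f z * fderiv ℝ χ z v = -∫ z, fderiv ℝ f z v * χ z := fun v =>
    integral_mul_fderiv_eq_neg_fderiv_mul_of_integrable (hi' v) (hi v) hi0
      (fun z _ => (hf.differentiable (by simp)) z) (fun z _ => (hχ.differentiable (by simp)) z)
  have e : ∀ z, f z * crDeriv j χ z = f z * fderiv ℝ χ z (EuclideanSpace.single j 1, 0) -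
      Complex.I * (f z * fderiv ℝ χ z (0, EuclideanSpace.single j 1)) := fun z => by
    rw [crDeriv]; ring
  simp_rw [e]
  have h0 : (∫ z, fderiv ℝ f z (EuclideanSpace.single j 1, 0) * χ z) -
      Complex.I * ∫ z, fderiv ℝ f z (0, EuclideanSpace.single j 1) * χ z = 0 := by
    rw [← integral_const_mul, ← integral_sub (hi' _) ((hi' _).const_mul _)]
    refine integral_eq_zero_of_ae (ae_of_all _ fun z => ?_)
    simp only [Pi.zero_apply, ← mul_assoc, ← sub_mul]
    exact mul_eq_zero_of_left (hf0 z) _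
  rw [integral_sub (hi _) ((hi _).const_mul _), integral_const_mul, hp, hp]
  linear_combination -h0

theorem exp_phaseSq_eq {N : ℕ} (ħ : ℝ) (z : Phase N) :
    (Real.exp ((1 / (4 * ħ)) * (‖z.1‖ ^ 2 + ‖z.2‖ ^ 2)) : ℂ) =
      phaseExp (-(1 / (4 * ħ))) 0 0 z := by
  rw [phaseExp_zero, neg_neg]
  rfl

theorem locallyIntegrable_phaseExp_mul {N : ℕ} (a : ℝ) (α β : Fin N → ℂ)
    (Ψ : Lp ℂ 2 (volume : Measure (Phase N))) :
    LocallyIntegrable fun z => phaseExp a α β z * Ψ z :=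
  ((Lp.memLp Ψ).locallyIntegrable (by norm_num)).continuous_mul
    (contDiff_phaseExp a α β).continuous

theorem satisfiesCauchyRiemann_iff {N : ℕ} (ħ : ℝ) (j : Fin N)
    (Ψ : Lp ℂ 2 (volume : Measure (Phase N))) :
    (SatisfiesCauchyRiemann j fun z =>
      (Real.exp ((1 / (4 * ħ)) * (‖z.1‖ ^ 2 + ‖z.2‖ ^ 2)) : ℂ) * Ψ z) ↔
    ∀ χ : Phase N → ℂ, ContDiff ℝ ∞ χ → HasCompactSupport χ →
      ∫ z, phaseExp (-(1 / (4 * ħ))) 0 0 z * Ψ z * crDeriv j χ z = 0 := by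
  simp only [SatisfiesCauchyRiemann, exp_phaseSq_eq, locallyIntegrable_phaseExp_mul, true_and,
    neg_eq_zero]
  rfl

/-- For fixed `χ` the left side is the inner product of an L² function `k` of compact support with
`U ψ`, that is, of `U* k` with `ψ`. As `U* k` is orthogonal to every packet, it is zero. -/
theorem integral_wavePacketTransform_mul_crDeriv {N : ℕ} {ħ : ℝ} (hħ : 0 < ħ) (j : Fin N)
    (ψ : Lp ℂ 2 (volume : Measure (Config N))) {χ : Phase N → ℂ} (hχ : ContDiff ℝ ∞ χ)
    (hc : HasCompactSupport χ) :
    ∫ z, phaseExp (-(1 / (4 * ħ))) 0 0 z *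
      wavePacketTransform ħ hħ (standardGaussian N ħ hħ) ψ z * crDeriv j χ z = 0 := by
  have hk : MemLp (fun z => (starRingEnd ℂ) (phaseExp (-(1 / (4 * ħ))) 0 0 z * crDeriv j χ z)) 2 :=
    (((contDiff_phaseExp (-(1 / (4 * ħ))) 0 0).continuous.mul
      (continuous_crDeriv j hχ)).memLp_of_hasCompactSupport
      (hasCompactSupport_crDeriv j hc).mul_left).star
  have hin : ∀ Ψ : Lp ℂ 2 (volume : Measure (Phase N)), inner ℂ (hk.toLp _) Ψ =
      ∫ z, phaseExp (-(1 / (4 * ħ))) 0 0 z * Ψ z * crDeriv j χ z := fun Ψ => by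
    rw [inner_toLp_left]
    congr 1
    funext z
    rw [Complex.conj_conj]
    ring
  set T := (wavePacketIsometry hħ (norm_standardGaussian N hħ)).toContinuousLinearMap
  have hT : ∀ ψ, T ψ = wavePacketTransform ħ hħ (standardGaussian N ħ hħ) ψ := fun _ => rfl
  have h0 : ContinuousLinearMap.adjoint T (hk.toLp _) = 0 := by
    refine eq_zero_of_inner_gaussianPacket hħ fun γ => ?_
    obtain ⟨C, -, hC⟩ := wavePacketTransform_gaussianPacket hħ γ
    rw [ContinuousLinearMap.adjoint_inner_left, hT, hin]
    -- The growing weight cancels the Gaussian of the transformed packet, leaving the smooth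
    -- solution `exp(γ·w̄/2)`.
    have := integral_mul_crDeriv_eq_zero j (contDiff_phaseExp (N := N) 0 (fun j => γ j / 2) 0)
      (fun z => by simp [crDeriv_phaseExp]) hχ hc
    rw [← mul_zero C, ← this, ← integral_const_mul]
    refine integral_congr_ae ?_
    filter_upwards [hC] with z hz
    rw [hz, mul_left_comm, phaseExp_mul, mul_assoc]
    simp
  rw [← hin, ← hT, ← ContinuousLinearMap.adjoint_inner_left, h0, inner_zero_left]

/-! ### Gaussian test functions and the resulting differential equation. -/

theorem exists_smooth_cutoff (N : ℕ) : ∃ f : Phase N → ℂ, ContDiff ℝ ∞ f ∧ HasCompactSupport f ∧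
    (∀ z, ‖f z‖ ≤ 1) ∧ f 0 = 1 := by
  let f : ContDiffBump (0 : Phase N) := ⟨1, 2, one_pos, one_lt_two⟩
  refine ⟨fun z => ((f z : ℝ) : ℂ), Complex.ofRealCLM.contDiff.comp f.contDiff,
    f.hasCompactSupport.comp_left (g := Complex.ofReal) Complex.ofReal_zero, fun z => ?_, ?_⟩
  · rw [Complex.norm_real, Real.norm_of_nonneg f.nonneg]
    exact f.le_one
  · change ((f 0 : ℝ) : ℂ) = 1
    rw [f.one_of_mem_closedBall (Metric.mem_closedBall_self f.rIn_pos.le), Complex.ofReal_one]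

theorem crDeriv_comp_smul {N : ℕ} (j : Fin N) {f : Phase N → ℂ} (hf : ContDiff ℝ ∞ f) (c : ℝ)
    (z : Phase N) : crDeriv j (fun z => f (c • z)) z = c * crDeriv j f (c • z) := by
  have h : HasFDerivAt (fun z => f (c • z))
      ((fderiv ℝ f (c • z)).comp (c • ContinuousLinearMap.id ℝ (Phase N))) z :=
    ((hf.differentiable (by simp)) (c • z)).hasFDerivAt.comp z ((hasFDerivAt_id z).const_smul c)
  have e : ∀ v, fderiv ℝ f (c • z) (c • v) = c * fderiv ℝ f (c • z) v := fun v => by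
    rw [map_smul, Complex.real_smul]
  rw [crDeriv, crDeriv, h.fderiv]
  simp only [ContinuousLinearMap.comp_apply, smul_apply, ContinuousLinearMap.id_apply, e]
  ring

/-- Compact support of the test function is relaxed to weighted square integrability: `u` is
multiplied by the cutoff `f(z/(n+1))`. The term in which the derivative falls on the cutoff carries
a factor `1/(n+1)`, so dominated convergence removes it. -/
theorem integral_mul_crDeriv_eq_zero_of_memLp {N : ℕ} {a : ℝ} {j : Fin N}
    {Ψ : Lp ℂ 2 (volume : Measure (Phase N))}
    (hΨ : ∀ χ : Phase N → ℂ, ContDiff ℝ ∞ χ → HasCompactSupport χ →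
      ∫ z, phaseExp a 0 0 z * Ψ z * crDeriv j χ z = 0)
    {u : Phase N → ℂ} (hu : ContDiff ℝ ∞ u) (h0 : MemLp (fun z => phaseExp a 0 0 z * u z) 2)
    (h1 : MemLp (fun z => phaseExp a 0 0 z * crDeriv j u z) 2) :
    ∫ z, phaseExp a 0 0 z * Ψ z * crDeriv j u z = 0 := by
  obtain ⟨f, hs, hc, hf1, hf0⟩ := exists_smooth_cutoff N
  obtain ⟨C, hC⟩ := (hasCompactSupport_crDeriv j hc).exists_bound_of_continuous
    (continuous_crDeriv j hs)
  set c : ℕ → ℝ := fun n => 1 / ((n : ℝ) + 1) with hcdef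
  have hc0 : ∀ n, 0 < c n := fun n => by simp only [hcdef]; positivity
  have hc1 : ∀ n, c n ≤ 1 := fun n => by
    simp only [hcdef]
    rw [div_le_one (by positivity)]
    linarith [(Nat.cast_nonneg n : (0 : ℝ) ≤ n)]
  have hclim : Filter.Tendsto c Filter.atTop (nhds 0) := tendsto_one_div_add_atTop_nhds_zero_nat
  have hs' : ∀ n, ContDiff ℝ ∞ fun z => f (c n • z) := fun n =>
    hs.comp (contDiff_const_smul (c n))
  have hχ : ∀ n, ContDiff ℝ ∞ fun z => f (c n • z) * u z := fun n => (hs' n).mul hu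
  have hχc : ∀ n, HasCompactSupport fun z => f (c n • z) * u z := fun n =>
    (hc.comp_homeomorph (Homeomorph.smulOfNeZero (c n) (hc0 n).ne')).mul_right
  have hd : ∀ n z, crDeriv j (fun z => f (c n • z) * u z) z = f (c n • z) * crDeriv j u z +
      c n * crDeriv j f (c n • z) * u z := fun n z => by
    rw [crDeriv_mul j ((hs' n).differentiable (by simp) z) (hu.differentiable (by simp) z),
      crDeriv_comp_smul j hs]
  have hzero : ∀ n, ∫ z, phaseExp a 0 0 z * Ψ z *
      crDeriv j (fun z => f (c n • z) * u z) z = 0 := fun n => hΨ _ (hχ n) (hχc n)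
  have hi0 := ((Lp.memLp Ψ).integrable_mul h0).norm
  have hi1 := ((Lp.memLp Ψ).integrable_mul h1).norm
  have hlim := tendsto_integral_of_dominated_convergence (μ := volume)
    (F := fun n z => phaseExp a 0 0 z * Ψ z * crDeriv j (fun z => f (c n • z) * u z) z)
    (f := fun z => phaseExp a 0 0 z * Ψ z * crDeriv j u z) _
    (fun n => (((contDiff_phaseExp a 0 0).continuous.aestronglyMeasurable.mul
      (Lp.aestronglyMeasurable Ψ)).mul (continuous_crDeriv j (hχ n)).aestronglyMeasurable))
    (hi1.add (hi0.const_mul C)) (fun n => ae_of_all _ fun z => ?_) (ae_of_all _ fun z => ?_)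
  · simp_rw [hzero] at hlim
    exact (tendsto_nhds_unique hlim tendsto_const_nhds)
  · rw [hd]
    have e : phaseExp a 0 0 z * Ψ z * (f (c n • z) * crDeriv j u z +
        c n * crDeriv j f (c n • z) * u z) =
        f (c n • z) * (Ψ z * (phaseExp a 0 0 z * crDeriv j u z)) +
        (c n * crDeriv j f (c n • z)) * (Ψ z * (phaseExp a 0 0 z * u z)) := by
      ring
    rw [e]
    refine (norm_add_le _ _).trans ?_
    rw [norm_mul, norm_mul (_ * _) (Ψ z * _)]
    refine add_le_add (mul_le_of_le_one_left (norm_nonneg _) ?_)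
      (mul_le_mul_of_nonneg_right ?_ (norm_nonneg _))
    · exact hf1 _
    · rw [norm_mul, Complex.norm_real, Real.norm_of_nonneg (hc0 n).le]
      exact (mul_le_of_le_one_left (norm_nonneg _) (hc1 n)).trans (hC _)
  · simp_rw [hd]
    refine Filter.Tendsto.const_mul _ ?_
    have hz : Filter.Tendsto (fun n => c n • z) Filter.atTop (nhds 0) := by
      simpa using hclim.smul_const z
    have l1 : Filter.Tendsto (fun n => f (c n • z)) Filter.atTop (nhds 1) := by
      have := (hs.continuous.tendsto 0).comp hz
      rwa [hf0] at this
    have l2 : Filter.Tendsto (fun n => crDeriv j f (c n • z)) Filter.atTop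
        (nhds _) := ((continuous_crDeriv j hs).tendsto 0).comp hz
    have l3 := (Complex.continuous_ofReal.tendsto 0).comp hclim
    simpa using (l1.mul_const (crDeriv j u z)).add ((l3.mul l2).mul_const (u z))

/-- The test function has Gaussian rate `1/(2ħ)`, so that the growing weight brings it down to
`1/(4ħ)`. The left side is formally `∂I/∂α_j`, which makes this the differential equation for `I`.
-/
theorem integral_conjCoord_mul_phaseExp {N : ℕ} {ħ : ℝ} (hħ : 0 < ħ) {j : Fin N}
    {Ψ : Lp ℂ 2 (volume : Measure (Phase N))}
    (hΨ : ∀ χ : Phase N → ℂ, ContDiff ℝ ∞ χ → HasCompactSupport χ →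
      ∫ z, phaseExp (-(1 / (4 * ħ))) 0 0 z * Ψ z * crDeriv j χ z = 0) (α β : Fin N → ℂ) :
    ∫ z, Ψ z * (conjCoord j z * phaseExp (1 / (4 * ħ)) α β z) =
      2 * ħ * β j * ∫ z, Ψ z * phaseExp (1 / (4 * ħ)) α β z := by
  have hħ' : (ħ : ℂ) ≠ 0 := by exact_mod_cast hħ.ne'
  have ha : 0 < 1 / (4 * ħ) := by positivity
  have e0 : ∀ z, phaseExp (-(1 / (4 * ħ))) 0 0 z * phaseExp (1 / (2 * ħ)) α β z =
      phaseExp (1 / (4 * ħ)) α β z := fun z => by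
    rw [phaseExp_mul, zero_add, zero_add]
    congr 1
    field_simp
    norm_num
  have e1 : ∀ z, phaseExp (-(1 / (4 * ħ))) 0 0 z * crDeriv j (phaseExp (1 / (2 * ħ)) α β) z =
      2 * β j * phaseExp (1 / (4 * ħ)) α β z -
        (1 / ħ : ℂ) * (conjCoord j z * phaseExp (1 / (4 * ħ)) α β z) := fun z => by
    rw [crDeriv_phaseExp, ← e0]
    push_cast
    field_simp
  have m0 := memLp_phaseExp ha α β
  have m1 := memLp_conjCoord_mul_phaseExp ha α β j
  have key := integral_mul_crDeriv_eq_zero_of_memLp hΨ (contDiff_phaseExp (1 / (2 * ħ)) α β)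
    (by simpa only [e0] using m0)
    (by simp only [e1]; exact (m0.const_mul (2 * β j)).sub (m1.const_mul (1 / ħ : ℂ)))
  have e2 : ∀ z, phaseExp (-(1 / (4 * ħ))) 0 0 z * Ψ z *
      crDeriv j (phaseExp (1 / (2 * ħ)) α β) z =
      2 * β j * (Ψ z * phaseExp (1 / (4 * ħ)) α β z) -
        (1 / ħ : ℂ) * (Ψ z * (conjCoord j z * phaseExp (1 / (4 * ħ)) α β z)) := fun z => by
    rw [mul_right_comm, e1]
    ring
  simp_rw [e2] at key
  have i0 : Integrable fun z => Ψ z * phaseExp (1 / (4 * ħ)) α β z :=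
    (Lp.memLp Ψ).integrable_mul m0
  have i1 : Integrable fun z => Ψ z * (conjCoord j z * phaseExp (1 / (4 * ħ)) α β z) :=
    (Lp.memLp Ψ).integrable_mul m1
  rw [integral_sub (i0.const_mul _) (i1.const_mul _), integral_const_mul, integral_const_mul,
    sub_eq_zero] at key
  generalize ∫ z, Ψ z * (conjCoord j z * phaseExp (1 / (4 * ħ)) α β z) = A at key ⊢
  generalize ∫ z, Ψ z * phaseExp (1 / (4 * ħ)) α β z = B at key ⊢
  field_simp at key
  linear_combination -key

theorem hasDerivAt_integral_mul_phaseExp {N : ℕ} {a : ℝ} (ha : 0 < a) (α β : Fin N → ℂ)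
    (Ψ : Lp ℂ 2 (volume : Measure (Phase N))) (t : ℝ) :
    HasDerivAt (fun t : ℝ => ∫ z, Ψ z * phaseExp a (fun j => t * α j) β z)
      (∑ j, α j * ∫ z, Ψ z * (conjCoord j z * phaseExp a (fun j => t * α j) β z)) t := by
  -- `C` bounds the coefficients `sα, β` for all `s` in the unit ball around `t`. `K` is the
  -- resulting constant of `exp_neg_phaseSq_add_le` at rate `C + 1`, times `∑ ‖α j‖`.
  set C : ℝ := (|t| + 1) * ∑ j, ‖α j‖ + ∑ j, ‖β j‖ with hCdef
  set K : ℝ := (∑ j, ‖α j‖) * Real.exp ((C + 1) ^ 2 / a) with hKdef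
  have hi : ∀ (t : ℝ) (j : Fin N), Integrable fun z =>
      Ψ z * (conjCoord j z * phaseExp a (fun j => t * α j) β z) := fun t j =>
    (Lp.memLp Ψ).integrable_mul (memLp_conjCoord_mul_phaseExp ha _ β j)
  have hsum : ∫ z, Ψ z * ((∑ j, α j * conjCoord j z) * phaseExp a (fun j => t * α j) β z) =
      ∑ j, α j * ∫ z, Ψ z * (conjCoord j z * phaseExp a (fun j => t * α j) β z) := by
    simp_rw [← integral_const_mul]
    rw [← integral_finsetSum _ fun j _ => (hi t j).const_mul (α j)]
    congr 1
    funext z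
    rw [Finset.sum_mul, Finset.mul_sum]
    exact Finset.sum_congr rfl fun _ _ => by ring
  rw [← hsum]
  have hmeas : ∀ t : ℝ, AEStronglyMeasurable
      (fun z => Ψ z * phaseExp a (fun j => t * α j) β z) volume := fun t =>
    (Lp.aestronglyMeasurable Ψ).mul (contDiff_phaseExp a _ β).continuous.aestronglyMeasurable
  refine (hasDerivAt_integral_of_dominated_loc_of_deriv_le
    (F := fun (t : ℝ) z => Ψ z * phaseExp a (fun j => t * α j) β z)
    (F' := fun (t : ℝ) z => Ψ z * ((∑ j, α j * conjCoord j z) *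
      phaseExp a (fun j => t * α j) β z))
    (bound := fun z => ‖Ψ z‖ * (K * Real.exp (-(a / 2) * phaseSq z)))
    (Metric.ball_mem_nhds t one_pos) (Filter.Eventually.of_forall hmeas)
    ((Lp.memLp Ψ).integrable_mul (memLp_phaseExp ha _ β)) ?_ ?_ ?_ ?_).2
  · refine (Lp.aestronglyMeasurable Ψ).mul (Continuous.aestronglyMeasurable ?_)
    have := (contDiff_phaseExp a (fun j => t * α j) β).continuous
    fun_prop
  · refine ae_of_all _ fun z s hs => ?_
    have hs' : |s| ≤ |t| + 1 := by
      rw [Metric.mem_ball, Real.dist_eq] at hs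
      have := abs_sub_abs_le_abs_sub s t
      linarith
    have hC : ∑ j, ‖(s : ℂ) * α j‖ + ∑ j, ‖β j‖ ≤ C := by
      simp_rw [norm_mul, Complex.norm_real, Real.norm_eq_abs]
      rw [← Finset.mul_sum]
      simp only [hCdef]
      gcongr
    rw [norm_mul]
    refine mul_le_mul_of_nonneg_left ?_ (norm_nonneg _)
    rw [Finset.sum_mul, hKdef, mul_assoc, Finset.sum_mul]
    refine norm_sum_le_of_le _ fun j _ => ?_
    rw [mul_assoc, norm_mul]
    refine mul_le_mul_of_nonneg_left ?_ (norm_nonneg _)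
    exact (norm_conjCoord_mul_phaseExp_le hC j z).trans (exp_neg_phaseSq_add_le ha _ z)
  · exact (Lp.memLp Ψ).norm.integrable_mul ((memLp_exp_neg_phaseSq (half_pos ha)).const_mul K)
  · refine ae_of_all _ fun z s _ => ?_
    have h1 : HasDerivAt (fun s : ℝ => ∑ j, (s * α j) * conjCoord j z)
        (∑ j, α j * conjCoord j z) s := by
      refine HasDerivAt.fun_sum fun j _ => ?_
      simpa using ((Complex.ofRealCLM.hasDerivAt (x := s)).mul_const (α j)).mul_const
        (conjCoord j z)
    have h2 := (((h1.const_add (-(a : ℂ) * (phaseSq z : ℂ))).add_const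
      (∑ j, β j * coord j z)).cexp).const_mul (Ψ z)
    refine h2.congr_deriv ?_
    rw [phaseExp]
    ring

/-- Along the ray `tα` the integral satisfies `h' = c h` with `c = 2ħ α·β`; so `exp(-ct) h(t)` is
constant, and `h(0) = 0` forces `h(1) = 0`. -/
theorem integral_mul_phaseExp_eq_zero {N : ℕ} {ħ : ℝ} (hħ : 0 < ħ)
    {Ψ : Lp ℂ 2 (volume : Measure (Phase N))}
    (hΨ : ∀ j : Fin N, ∀ χ : Phase N → ℂ, ContDiff ℝ ∞ χ → HasCompactSupport χ →
      ∫ z, phaseExp (-(1 / (4 * ħ))) 0 0 z * Ψ z * crDeriv j χ z = 0) (α β : Fin N → ℂ)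
    (h0 : ∫ z, Ψ z * phaseExp (1 / (4 * ħ)) 0 β z = 0) :
    ∫ z, Ψ z * phaseExp (1 / (4 * ħ)) α β z = 0 := by
  set h : ℝ → ℂ := fun t => ∫ z, Ψ z * phaseExp (1 / (4 * ħ)) (fun j => t * α j) β z with hdef
  set c : ℂ := ∑ j, α j * (2 * ħ * β j) with hc
  have hh : ∀ t, HasDerivAt h (c * h t) t := fun t => by
    have := hasDerivAt_integral_mul_phaseExp (a := 1 / (4 * ħ)) (by positivity) α β Ψ t
    simp_rw [integral_conjCoord_mul_phaseExp hħ (hΨ _), ← mul_assoc, ← Finset.sum_mul] at this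
    simpa only [hc, mul_assoc] using! this
  have hg : ∀ t : ℝ, HasDerivAt (fun t : ℝ => Complex.exp (-(c * t)) * h t) 0 t := fun t => by
    have h1 : HasDerivAt (fun t : ℝ => Complex.exp (-(c * t)))
        (Complex.exp (-(c * t)) * -(c * 1)) t :=
      (((Complex.ofRealCLM.hasDerivAt (x := t)).const_mul c).neg).cexp
    refine (h1.mul (hh t)).congr_deriv ?_
    ring
  have e := is_const_of_deriv_eq_zero (fun t => (hg t).differentiableAt)
    (fun t => (hg t).deriv) 1 0
  have hh0 : h 0 = 0 := by
    rw [← h0, hdef]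
    simp only [Complex.ofReal_zero, zero_mul]
    rfl
  have hh1 : h 1 = ∫ z, Ψ z * phaseExp (1 / (4 * ħ)) α β z := by
    rw [hdef]
    simp only [Complex.ofReal_one, one_mul]
  simp only [hh0, mul_zero] at e
  rw [← hh1]
  exact (mul_eq_zero.1 e).resolve_left (Complex.exp_ne_zero _)

/-! ### Solutions orthogonal to the range vanish. -/

/-- The coefficients solve `α + β = -iξ` and `i(β - α) = -iη`, which turns the linear exponent into
a plane wave. -/
theorem phaseExp_fourier {N : ℕ} (a : ℝ) (ξ η : Config N) (z : Phase N) :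
    phaseExp a (fun j => ((η j : ℂ) - Complex.I * ξ j) / 2)
      (fun j => (-(η j : ℂ) - Complex.I * ξ j) / 2) z =
    phaseExp a 0 0 z *
      Complex.exp (-(Complex.I * ((inner ℝ ξ z.1 + inner ℝ η z.2 : ℝ) : ℂ))) := by
  rw [phaseExp, phaseExp, ← Complex.exp_add]
  congr 1
  simp only [Pi.zero_apply, zero_mul, Finset.sum_const_zero, add_zero, add_assoc,
    ← Finset.sum_add_distrib, PiLp.inner_apply, RCLike.inner_apply, conj_trivial]
  push_cast
  rw [Finset.mul_sum, ← Finset.sum_neg_distrib]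
  congr 1
  refine Finset.sum_congr rfl fun j _ => ?_
  rw [conjCoord_apply, coord_apply]
  ring

theorem eq_zero_of_integral_mul_phaseExp {N : ℕ} {a : ℝ} (ha : 0 < a)
    {Ψ : Lp ℂ 2 (volume : Measure (Phase N))}
    (h : ∀ α β : Fin N → ℂ, ∫ z, Ψ z * phaseExp a α β z = 0) : Ψ = 0 := by
  have hb : MemLp (phaseExp (N := N) a 0 0) ⊤ := by
    refine memLp_top_of_bound (contDiff_phaseExp a 0 0).continuous.aestronglyMeasurable 1
      (ae_of_all _ fun z => ?_)
    rw [phaseExp_zero, Complex.norm_real, Real.norm_of_nonneg (Real.exp_nonneg _),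
      Real.exp_le_one_iff, neg_mul, neg_nonpos, phaseSq]
    positivity
  have key : (fun z => Ψ z * phaseExp a 0 0 z) =ᵐ[volume] 0 := by
    refine ae_eq_zero_of_phase_fourier_eq_zero
      ((Lp.memLp Ψ).integrable_mul (memLp_phaseExp ha 0 0)) (hb.mul' (Lp.memLp Ψ)) fun ξ η => ?_
    simp_rw [mul_assoc, ← phaseExp_fourier]
    exact h _ _
  rw [Lp.eq_zero_iff_ae_eq_zero]
  filter_upwards [key] with z hz
  exact (mul_eq_zero.1 hz).resolve_right (phaseExp_ne_zero _ _ _ _)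

theorem conj_phaseExp {N : ℕ} (a : ℝ) (γ : Fin N → ℂ) (z : Phase N) :
    (starRingEnd ℂ) (phaseExp a γ 0 z) = phaseExp a 0 (fun j => (starRingEnd ℂ) (γ j)) z := by
  rw [phaseExp, phaseExp, ← Complex.exp_conj]
  congr 1
  simp [conjCoord_apply, coord_apply]

theorem eq_zero_of_orthogonal_range {N : ℕ} {ħ : ℝ} (hħ : 0 < ħ)
    {Ψ : Lp ℂ 2 (volume : Measure (Phase N))}
    (hΨ : ∀ j : Fin N, ∀ χ : Phase N → ℂ, ContDiff ℝ ∞ χ → HasCompactSupport χ →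
      ∫ z, phaseExp (-(1 / (4 * ħ))) 0 0 z * Ψ z * crDeriv j χ z = 0)
    (ho : ∀ ψ, inner ℂ (wavePacketTransform ħ hħ (standardGaussian N ħ hħ) ψ) Ψ = 0) :
    Ψ = 0 := by
  refine eq_zero_of_integral_mul_phaseExp (a := 1 / (4 * ħ)) (by positivity) fun α β =>
    integral_mul_phaseExp_eq_zero hħ hΨ α β ?_
  -- The transform halves the packet parameter and the inner product conjugates its first argument,
  -- so `2 β̄` produces exactly the exponent `β·w`.
  obtain ⟨C, hC, h⟩ := wavePacketTransform_gaussianPacket hħ fun j => 2 * (starRingEnd ℂ) (β j)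
  have e := ho ((memLp_gaussianPacket hħ fun j => 2 * (starRingEnd ℂ) (β j)).toLp _)
  have e' : ∫ z, (starRingEnd ℂ) C * (Ψ z * phaseExp (1 / (4 * ħ)) 0 β z) = 0 := by
    rw [← e, L2.inner_def]
    refine integral_congr_ae ?_
    filter_upwards [h] with z hz
    rw [hz, RCLike.inner_apply, map_mul, conj_phaseExp]
    have : (fun j => (starRingEnd ℂ) (2 * (starRingEnd ℂ) (β j) / 2)) = β := by
      funext j
      simp
    rw [this]
    ring
  rw [integral_const_mul] at e'
  exact (mul_eq_zero.1 e').resolve_left (by simpa using hC)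

/-! ### The range characterized, and the isometry between ranges. -/

theorem mem_wavePacketRange_iff {N : ℕ} {ħ : ℝ} (hħ : 0 < ħ)
    (Ψ : Lp ℂ 2 (volume : Measure (Phase N))) :
    Ψ ∈ wavePacketRange ħ hħ (standardGaussian N ħ hħ) ↔
      ∀ j : Fin N, ∀ χ : Phase N → ℂ, ContDiff ℝ ∞ χ → HasCompactSupport χ →
        ∫ z, phaseExp (-(1 / (4 * ħ))) 0 0 z * Ψ z * crDeriv j χ z = 0 := by
  constructor
  · rintro ⟨ψ, rfl⟩ j χ hχ hc
    exact integral_wavePacketTransform_mul_crDeriv hħ j ψ hχ hc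
  · intro hΨ
    set R := wavePacketRange ħ hħ (standardGaussian N ħ hħ) with hR
    have hcomplete : IsComplete (R : Set (Lp ℂ 2 (volume : Measure (Phase N)))) := by
      have := (wavePacketIsometry hħ (norm_standardGaussian N hħ)).isometry
        |>.isUniformInducing.isComplete_range
      rwa [hR, wavePacketRange, LinearMap.coe_range]
    have : CompleteSpace R := hcomplete.completeSpace_coe
    -- The range is complete, being the isometric image of a complete space. The component `s`
    -- inherits the equations because `r`, lying in the range, already satisfies them.
    obtain ⟨r, hr, s, hs, rfl⟩ := R.exists_add_mem_mem_orthogonal Ψ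
    suffices s = 0 by rwa [this, add_zero]
    refine eq_zero_of_orthogonal_range hħ (fun j χ hχ hc => ?_) fun ψ => hs _ ⟨ψ, rfl⟩
    obtain ⟨ψ, rfl⟩ := hr
    have h1 := integral_wavePacketTransform_mul_crDeriv hħ j ψ hχ hc
    have h2 := hΨ j χ hχ hc
    have hi : ∀ f : Lp ℂ 2 (volume : Measure (Phase N)), Integrable fun z =>
        phaseExp (-(1 / (4 * ħ))) 0 0 z * f z * crDeriv j χ z := fun f => by
      have := (locallyIntegrable_phaseExp_mul (-(1 / (4 * ħ))) 0 0
        f).integrable_smul_right_of_hasCompactSupport (continuous_crDeriv j hχ)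
        (hasCompactSupport_crDeriv j hc)
      simpa only [smul_eq_mul] using this
    rw [← h2, ← zero_add (∫ z, _ * s z * _), ← h1, ← integral_add (hi _) (hi _)]
    refine integral_congr_ae ?_
    filter_upwards [Lp.coeFn_add (wavePacketTransform ħ hħ (standardGaussian N ħ hħ) ψ) s]
      with z hz
    rw [hz, Pi.add_apply]
    ring

theorem nonempty_wavePacketRange_equiv {N : ℕ} {ħ : ℝ} (hħ : 0 < ħ) {φ φ' : 𝓢(Config N, ℂ)}
    (hφ : ‖φ.toLp 2‖ = 1) (hφ' : ‖φ'.toLp 2‖ = 1) :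
    Nonempty (wavePacketRange ħ hħ φ ≃ₗᵢ[ℂ] wavePacketRange ħ hħ φ') :=
  ⟨(wavePacketIsometry hħ hφ).equivRange.symm.trans (wavePacketIsometry hħ hφ').equivRange⟩

end WavePacket

end

theorem mainTheorem8 (N : ℕ) (ħ : ℝ) (hħ : 0 < ħ) :
    (∀ Ψ : Lp ℂ 2 (volume : Measure (WavePacket.Phase N)),
      Ψ ∈ WavePacket.wavePacketRange ħ hħ (WavePacket.standardGaussian N ħ hħ) ↔
        ∀ j : Fin N, WavePacket.SatisfiesCauchyRiemann j fun z =>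
          (Real.exp ((1 / (4 * ħ)) * (‖z.1‖ ^ 2 + ‖z.2‖ ^ 2)) : ℂ) * Ψ z) ∧
    (∀ φ : 𝓢(WavePacket.Config N, ℂ), ‖φ.toLp 2‖ = 1 →
      Nonempty (WavePacket.wavePacketRange ħ hħ φ ≃ₗᵢ[ℂ]
        WavePacket.wavePacketRange ħ hħ (WavePacket.standardGaussian N ħ hħ))) := by
  refine ⟨fun Ψ => ?_, fun φ hφ =>
    WavePacket.nonempty_wavePacketRange_equiv hħ hφ (WavePacket.norm_standardGaussian N hħ)⟩
  rw [WavePacket.mem_wavePacketRange_iff]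
  exact forall_congr' fun j => (WavePacket.satisfiesCauchyRiemann_iff ħ j Ψ).symm
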